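/- Let $X$ be a real Banach space and let $(x_n)_{n\in\mathbb N}$ be a symmetric basis of $X$; that is, every $v\in X$ has a unique expansion $v=\sum_n a(n)x_n$ with $a\in\mathbb R^{\mathbb N}$ (norm convergence of the partial sums), and for every permutation $\pi$ of $\mathbb N$ and every $a\in\mathbb R^{\mathbb N}$, the series $\sum_n a(n)x_{\pi(n)}$ converges if and only if $\sum_n a(n)x_n$ converges. Let $E(X,(x_n))$ be the equivalence relation on $\mathbb R^{\mathbb N}$ under which $a,b$ are equivalent iff $\sum_n (a(n)-b(n))x_n$ converges in $X$. For $a\in\mathbb R^{\mathbb N}$ put $$\|a\|_J=\frac1{\sqrt2}\sup\Big[(a(n_1)-a(n_2))^2+\dots+(a(n_{m-1})-a(n_m))^2+(a(n_m)-a(n_1))^2\Big]^{1/2},$$ the supremum being over all $m\ge 1$ and $n_1<\dots<n_m$ in $\mathbb N$. Let $J=\{a\in c_0:\|a\|_J<\infty\}$ be James' space, and let $\mathbb R^{\mathbb N}/J$ be the equivalence relation on $\mathbb R^{\mathbb N}$ under which $a,b$ are equivalent iff $a-b\in J$. For $n\ge1$ let $J^n$ be $\mathbb R^n$ with the norm $\|(r_0,\dots,r_{n-1})\|=\|(r_0,\dots,r_{n-1},0,0,\dots)\|_J$.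 Let $Z=(\bigoplus_{n\ge1}J^n)_2$ be the $\ell_2$-sum of these spaces, with each $J^n$ identified with its canonical copy in $Z$, and let $E(Z,(J^n))$ be the equivalence relation on $\prod_{n\ge1}J^n$ under which $\alpha,\beta$ are equivalent iff $\sum_n(\alpha(n)-\beta(n))$ converges in $Z$. For equivalence relations $E,F$ on Polish spaces $S,T$ write $E\le_B F$ if there is a Borel map $\theta:S\to T$ such that, for all $s,s'\in S$, $s\mathrel{E}s'$ if and only if $\theta(s)\mathrel{F}\theta(s')$. Then $$E(X,(x_n))\le_B\mathbb R^{\mathbb N}/J\iff E(X,(x_n))\le_B E\Big(\Big(\bigoplus_{n\ge1}J^n\Big)_2,(J^n)\Big).$$ -/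

import Mathlib

open Filter Topology
open scoped ENNReal

noncomputable section

/-! ### Borel reducibility -/

/-- `E` is Borel reducible to `F`: there is a Borel function `θ` (with respect to the Borel
σ-algebras of the two topologies) such that `x E y ↔ θ x F θ y`. -/
def BorelReducible {α β : Type*} [TopologicalSpace α] [TopologicalSpace β]
    (E : Setoid α) (F : Setoid β) : Prop :=
  ∃ θ : α → β, @Measurable α β (borel α) (borel β) θ ∧ ∀ x y : α, E x y ↔ F (θ x) (θ y)

/-- The equivalence relation `ℝ^ℕ / L` on `ℝ^ℕ` given by a linear subspace `L` of `ℝ^ℕ`: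
`a` and `b` are equivalent iff `a - b ∈ L`. -/
def sequenceSetoid (L : Submodule ℝ (ℕ → ℝ)) : Setoid (ℕ → ℝ) where
  r a b := a - b ∈ L
  iseqv :=
    { refl := fun a => by simp
      symm := fun {a b} h => by simpa using L.neg_mem h
      trans := fun {a b c} h h' => by simpa using L.add_mem h h' }

/-! ### Convergent series, bases, and the associated equivalence relations -/

section Bases

variable {X : Type*} [NormedAddCommGroup X]

/-- The series `∑ u n` converges (in the sense of partial sums) to `s`. -/
def SeriesConvergesTo (u : ℕ → X) (s : X) : Prop :=
  Tendsto (fun N : ℕ => ∑ n ∈ Finset.range N, u n) atTop (𝓝 s)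

/-- The series `∑ u n` converges (in the sense of partial sums). -/
def SeriesConverges (u : ℕ → X) : Prop :=
  ∃ s : X, SeriesConvergesTo u s

theorem SeriesConverges.zero : SeriesConverges (fun _ : ℕ => (0 : X)) :=
  ⟨0, by simp [SeriesConvergesTo]⟩

theorem SeriesConverges.add {u v : ℕ → X} (hu : SeriesConverges u) (hv : SeriesConverges v) :
    SeriesConverges (fun n => u n + v n) := by
  obtain ⟨s, hs⟩ := hu
  obtain ⟨t, ht⟩ := hv
  refine ⟨s + t, ?_⟩
  simpa [SeriesConvergesTo, Finset.sum_add_distrib] using Tendsto.add hs ht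

variable [NormedSpace ℝ X]

theorem SeriesConverges.smul {u : ℕ → X} (c : ℝ) (hu : SeriesConverges u) :
    SeriesConverges (fun n => c • u n) := by
  obtain ⟨s, hs⟩ := hu
  refine ⟨c • s, ?_⟩
  simpa [SeriesConvergesTo, Finset.smul_sum] using Tendsto.const_smul hs c

/-- `coef (X, (x n))`: the linear space of all real sequences `a` for which `∑ a n • x n`
converges in `X`. -/
def coef (x : ℕ → X) : Submodule ℝ (ℕ → ℝ) where
  carrier := {a | SeriesConverges (fun n => a n • x n)}
  zero_mem' := by
    simpa using! SeriesConverges.zero (X := X)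
  add_mem' := by
    intro a b ha hb
    simpa [add_smul] using! SeriesConverges.add ha hb
  smul_mem' := by
    intro c a ha
    simpa [mul_smul] using! SeriesConverges.smul c ha

/-- `x` is a Schauder basis of `X`: every vector has a unique expansion `∑ a n • x n`. -/
def IsSchauderBasis (x : ℕ → X) : Prop :=
  ∀ v : X, ∃! a : ℕ → ℝ, SeriesConvergesTo (fun n => a n • x n) v

/-- `x` is a symmetric basis of `X`: a Schauder basis which is equivalent to each of its
rearrangements, that is, has the same space of coefficients. -/
def IsSymmetricBasis (x : ℕ → X) : Prop :=
  IsSchauderBasis x ∧ ∀ π : Equiv.Perm ℕ, coef (fun n => x (π n)) = coef x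

/-- The Schauder equivalence relation `E (X, (x n)) = ℝ^ℕ / coef (X, (x n))`. -/
def schauderSetoid (x : ℕ → X) : Setoid (ℕ → ℝ) :=
  sequenceSetoid (coef x)

/-- The decomposition equivalence relation `E (X, (S n))` on `∏ S n`, for a sequence `S` of
subspaces of `X`: `α` and `β` are equivalent iff `∑ (α n - β n)` converges in `X`. -/
def decompositionSetoid (S : ℕ → Submodule ℝ X) : Setoid (∀ n, S n) where
  r α β := SeriesConverges (fun n => (α n : X) - (β n : X))
  iseqv :=
    { refl := fun α => by simpa using! SeriesConverges.zero (X := X)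
      symm := fun {α β} h => by simpa using! SeriesConverges.smul (-1) h
      trans := fun {α β γ} h h' => by simpa using! SeriesConverges.add h h' }

end Bases

/-! ### James' space -/

/-- The norm `‖a‖_J ∈ [0, ∞]` of a real sequence: `1 / √2` times the supremum, over all finite
nonempty increasing sequences `n 0 < ⋯ < n m`, of
`((a (n 0) - a (n 1))² + ⋯ + (a (n (m-1)) - a (n m))² + (a (n m) - a (n 0))²) ^ (1/2)`.
The addition `i + 1` in `Fin (m + 1)` is cyclic, so the last summand closes the cycle. -/
def jamesENorm (a : ℕ → ℝ) : ℝ≥0∞ :=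
  ⨆ (m : ℕ) (n : Fin (m + 1) ↪o ℕ),
    ENNReal.ofReal (√(∑ i : Fin (m + 1), (a (n i) - a (n (i + 1))) ^ 2) / √2)

theorem jamesENorm_zero : jamesENorm 0 = 0 := by
  simp [jamesENorm]

theorem jamesENorm_smul_le (c : ℝ) (a : ℕ → ℝ) :
    jamesENorm (c • a) ≤ ENNReal.ofReal |c| * jamesENorm a := by
  refine iSup₂_le fun m n => ?_
  have h : ∑ i : Fin (m + 1), ((c • a) (n i) - (c • a) (n (i + 1))) ^ 2
      = c ^ 2 * ∑ i : Fin (m + 1), (a (n i) - a (n (i + 1))) ^ 2 := by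
    rw [Finset.mul_sum]
    refine Finset.sum_congr rfl fun i _ => ?_
    simp only [Pi.smul_apply, smul_eq_mul]
    ring
  rw [h, Real.sqrt_mul (sq_nonneg c), Real.sqrt_sq_eq_abs, mul_div_assoc,
    ENNReal.ofReal_mul (abs_nonneg c)]
  gcongr
  exact le_iSup₂ (f := fun (m : ℕ) (n : Fin (m + 1) ↪o ℕ) =>
    ENNReal.ofReal (√(∑ i : Fin (m + 1), (a (n i) - a (n (i + 1))) ^ 2) / √2)) m n

theorem jamesENorm_add_le (a b : ℕ → ℝ) :
    jamesENorm (a + b) ≤ jamesENorm a + jamesENorm b := by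
  refine iSup₂_le fun m n => ?_
  have key : √(∑ i : Fin (m + 1), ((a + b) (n i) - (a + b) (n (i + 1))) ^ 2)
      ≤ √(∑ i : Fin (m + 1), (a (n i) - a (n (i + 1))) ^ 2)
        + √(∑ i : Fin (m + 1), (b (n i) - b (n (i + 1))) ^ 2) := by
    have h := norm_add_le
      (WithLp.toLp 2 (fun i : Fin (m + 1) => a (n i) - a (n (i + 1))))
      (WithLp.toLp 2 (fun i : Fin (m + 1) => b (n i) - b (n (i + 1))))
    simp only [EuclideanSpace.norm_eq, PiLp.add_apply, Real.norm_eq_abs, sq_abs] at h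
    convert h using 5
    simp only [Pi.add_apply]
    ring
  calc ENNReal.ofReal (√(∑ i : Fin (m + 1), ((a + b) (n i) - (a + b) (n (i + 1))) ^ 2) / √2)
      ≤ ENNReal.ofReal (√(∑ i : Fin (m + 1), (a (n i) - a (n (i + 1))) ^ 2) / √2
        + √(∑ i : Fin (m + 1), (b (n i) - b (n (i + 1))) ^ 2) / √2) := by
        rw [← add_div]
        gcongr
    _ ≤ _ := by
        refine ENNReal.ofReal_add_le.trans (add_le_add ?_ ?_)
        · exact le_iSup₂ (f := fun (m : ℕ) (n : Fin (m + 1) ↪o ℕ) =>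
            ENNReal.ofReal (√(∑ i : Fin (m + 1), (a (n i) - a (n (i + 1))) ^ 2) / √2)) m n
        · exact le_iSup₂ (f := fun (m : ℕ) (n : Fin (m + 1) ↪o ℕ) =>
            ENNReal.ofReal (√(∑ i : Fin (m + 1), (b (n i) - b (n (i + 1))) ^ 2) / √2)) m n

/-- James' space `J = c₀ ∩ {a | ‖a‖_J < ∞}`, as a linear subspace of `ℝ^ℕ`. -/
def jamesSpace : Submodule ℝ (ℕ → ℝ) where
  carrier := {a | Tendsto a atTop (𝓝 0) ∧ jamesENorm a < ∞}
  zero_mem' := ⟨tendsto_const_nhds, by simp [jamesENorm_zero]⟩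
  add_mem' := by
    rintro a b ⟨ha, ha'⟩ ⟨hb, hb'⟩
    exact ⟨by simpa using! ha.add hb,
      (jamesENorm_add_le a b).trans_lt (ENNReal.add_lt_top.2 ⟨ha', hb'⟩)⟩
  smul_mem' := by
    rintro c a ⟨ha, ha'⟩
    exact ⟨by simpa using! ha.const_mul c,
      (jamesENorm_smul_le c a).trans_lt (ENNReal.mul_lt_top ENNReal.ofReal_lt_top ha')⟩

/-! ### The finite dimensional spaces `J^n` -/

/-- The space `J^n`: the vector space `ℝ^n`, which carries below the norm
`‖(r 0, …, r (n-1))‖ = ‖(r 0, …, r (n-1), 0, 0, …)‖_J`. -/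
def JamesFin (n : ℕ) : Type := Fin n → ℝ

instance (n : ℕ) : AddCommGroup (JamesFin n) := inferInstanceAs (AddCommGroup (Fin n → ℝ))

instance (n : ℕ) : Module ℝ (JamesFin n) := inferInstanceAs (Module ℝ (Fin n → ℝ))

/-- The sequence `(r 0, …, r (n-1), 0, 0, …)`. -/
def padZero {n : ℕ} (r : JamesFin n) : ℕ → ℝ :=
  fun k => if h : k < n then r ⟨k, h⟩ else 0

theorem padZero_zero {n : ℕ} : padZero (0 : JamesFin n) = 0 := by
  ext k
  by_cases h : k < n
  · simp only [padZero, h, dif_pos]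
    rfl
  · simp [padZero, h]

theorem padZero_add {n : ℕ} (r s : JamesFin n) : padZero (r + s) = padZero r + padZero s := by
  ext k
  by_cases h : k < n
  · simp only [padZero, Pi.add_apply, h, dif_pos]
    rfl
  · simp [padZero, h]

theorem padZero_smul {n : ℕ} (c : ℝ) (r : JamesFin n) : padZero (c • r) = c • padZero r := by
  ext k
  by_cases h : k < n
  · simp only [padZero, Pi.smul_apply, h, dif_pos]
    rfl
  · simp [padZero, h]

theorem jamesENorm_padZero_lt_top {n : ℕ} (r : JamesFin n) : jamesENorm (padZero r) < ∞ := by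
  set a := padZero r with ha
  set C : ℝ := ∑ k ∈ Finset.range n, a k ^ 2 with hC
  have hbound : ∀ (m : ℕ) (f : Fin (m + 1) → ℕ), Function.Injective f →
      ∑ i, a (f i) ^ 2 ≤ C := by
    intro m f hf
    have h1 : ∑ i, a (f i) ^ 2 = ∑ k ∈ Finset.univ.map ⟨f, hf⟩, a k ^ 2 := by
      simp
    rw [h1, ← Finset.sum_filter_add_sum_filter_not _ (fun k => k < n)]
    have h2 : ∑ k ∈ (Finset.univ.map ⟨f, hf⟩).filter (fun k => ¬ k < n), a k ^ 2 = 0 := by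
      refine Finset.sum_eq_zero fun k hk => ?_
      have hk' := (Finset.mem_filter.1 hk).2
      simp [ha, padZero, hk']
    rw [h2, add_zero]
    refine Finset.sum_le_sum_of_subset_of_nonneg ?_ fun _ _ _ => sq_nonneg _
    intro k hk
    exact Finset.mem_range.2 (Finset.mem_filter.1 hk).2
  refine lt_of_le_of_lt (iSup₂_le fun m f => ?_)
    (ENNReal.ofReal_lt_top (r := √(2 * C + 2 * C) / √2))
  gcongr
  calc ∑ i : Fin (m + 1), (a (f i) - a (f (i + 1))) ^ 2
      ≤ ∑ i : Fin (m + 1), (2 * a (f i) ^ 2 + 2 * a (f (i + 1)) ^ 2) :=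
        Finset.sum_le_sum fun i _ => by nlinarith [sq_nonneg (a (f i) + a (f (i + 1)))]
    _ = 2 * ∑ i : Fin (m + 1), a (f i) ^ 2 + 2 * ∑ i : Fin (m + 1), a (f (i + 1)) ^ 2 := by
        rw [Finset.sum_add_distrib, Finset.mul_sum, Finset.mul_sum]
    _ ≤ 2 * C + 2 * C := by
        have h1 := hbound m f f.injective
        have h2 := hbound m (fun i => f (i + 1))
          (f.injective.comp (add_left_injective 1))
        linarith

theorem abs_sub_le_jamesENorm (a : ℕ → ℝ) {k l : ℕ} (h : k < l) :
    ENNReal.ofReal |a k - a l| ≤ jamesENorm a := by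
  let f : Fin 2 ↪o ℕ := OrderEmbedding.ofStrictMono ![k, l] (by
    intro i j hij
    fin_cases i <;> fin_cases j <;> simp_all)
  refine le_trans (le_of_eq ?_) (le_iSup₂ (f := fun (m : ℕ) (n : Fin (m + 1) ↪o ℕ) =>
    ENNReal.ofReal (√(∑ i : Fin (m + 1), (a (n i) - a (n (i + 1))) ^ 2) / √2)) 1 f)
  have h0 : f 0 = k := rfl
  have h1 : f 1 = l := rfl
  have hs : ∑ i : Fin (1 + 1), (a (f i) - a (f (i + 1))) ^ 2 = 2 * (a k - a l) ^ 2 := by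
    rw [Fin.sum_univ_two]
    have e1 : (0 : Fin 2) + 1 = 1 := rfl
    have e2 : (1 : Fin 2) + 1 = 0 := rfl
    rw [e1, e2, h0, h1]
    ring
  simp only [hs]
  congr 1
  rw [Real.sqrt_mul (by norm_num), Real.sqrt_sq_eq_abs]
  field_simp

namespace JamesFin

variable {n : ℕ}

/-- The norm of `J^n` as a group norm; it is finite on all of `ℝ^n`. -/
def groupNorm (n : ℕ) : AddGroupNorm (JamesFin n) where
  toFun r := (jamesENorm (padZero r)).toReal
  map_zero' := by
    simp [padZero_zero, jamesENorm_zero]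
  add_le' r s := by
    rw [padZero_add, ← ENNReal.toReal_add (jamesENorm_padZero_lt_top r).ne
      (jamesENorm_padZero_lt_top s).ne]
    exact ENNReal.toReal_mono (ENNReal.add_lt_top.2
      ⟨jamesENorm_padZero_lt_top r, jamesENorm_padZero_lt_top s⟩).ne (jamesENorm_add_le _ _)
  neg' r := by
    have h : padZero (-r) = (-1 : ℝ) • padZero r := by
      rw [← padZero_smul, neg_one_smul]
    have h' : padZero r = (-1 : ℝ) • padZero (-r) := by
      rw [h, smul_smul]
      simp
    congr 1
    refine le_antisymm ?_ ?_
    · rw [h]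
      simpa using jamesENorm_smul_le (-1) (padZero r)
    · conv_lhs => rw [h']
      simpa using jamesENorm_smul_le (-1) (padZero (-r))
  eq_zero_of_map_eq_zero' r hr := by
    have h0 : jamesENorm (padZero r) = 0 :=
      ((ENNReal.toReal_eq_zero_iff _).1 hr).resolve_right (jamesENorm_padZero_lt_top r).ne
    funext k
    have h1 := abs_sub_le_jamesENorm (padZero r) k.2
    rw [h0, nonpos_iff_eq_zero, ENNReal.ofReal_eq_zero] at h1
    have h2 := abs_nonpos_iff.1 h1
    simpa [padZero] using! h2

instance : NormedAddCommGroup (JamesFin n) := (groupNorm n).toNormedAddCommGroup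

theorem norm_def (r : JamesFin n) : ‖r‖ = (jamesENorm (padZero r)).toReal := rfl

instance : NormedSpace ℝ (JamesFin n) where
  norm_smul_le c r := by
    rw [norm_def, norm_def, padZero_smul, Real.norm_eq_abs, ← ENNReal.toReal_ofReal (abs_nonneg c),
      ← ENNReal.toReal_mul]
    exact ENNReal.toReal_mono
      (ENNReal.mul_lt_top ENNReal.ofReal_lt_top (jamesENorm_padZero_lt_top r)).ne
      (jamesENorm_smul_le c _)

end JamesFin

/-- The Hilbert sum `(⨁_{n ≥ 1} J^n)_2`; the index `k` stands for `n = k + 1`. -/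
abbrev JamesSum : Type := lp (fun k : ℕ => JamesFin (k + 1)) 2

/-- The copy of `J^n`, `n = k + 1`, inside `(⨁_{n ≥ 1} J^n)_2`: the vectors which vanish off the
`k`-th coordinate. -/
def jamesSummand (k : ℕ) : Submodule ℝ JamesSum :=
  LinearMap.range (lp.lsingle (𝕜 := ℝ) (E := fun k : ℕ => JamesFin (k + 1)) 2 k)

end

/-! Up to a factor 2, the square of the James norm is the quadratic variation `sqVar` over linear
chains, which behaves well when a sequence is cut into consecutive blocks. It is at most twice the
sum of the variations of the blocks (`sqVar_le_two_mul_tsum_block`), and at least that sum if the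
sequence vanishes at the left end of every block (`tsum_sqVar_block_le`). So, for sequences with
such separating zeros, lying in `J` means that the block norms are square summable.

Passing from the Hilbert sum to `J` is therefore a matter of concatenating the finite sequences with
a zero before each; this does not involve `X`.

Conversely, let `θ` reduce the relation of `X` to that of `J`. A symmetric basis is unconditional,
has norms bounded above and away from zero, and is equivalent to each of its injective reindexings.
Hence a real sequence can be replaced by one with values in `[0, 1]`, supported on any prescribed
infinite set of indices (`spread`), and then rounded to the grid of mesh `2⁻ⁿ` at place `n`. What
remains is a relation on a product of finite sets. There `θ` is continuous on a comeager set
invariant under finite changes, and a finite change moves `θ` by an element of `J`, whose tails have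
small variation. Baire category yields a generic point `g` near which both effects are uniform
(`exists_generic`): early coordinates hardly influence `θ` far out, and late ones hardly influence
its beginning.

Freeze all coordinates at `g` except a sparse sequence of free ones. Up to a summable error, the
`j`-th block of `θ` then depends on the `j`-th free coordinate alone (`exists_block_decomposition`).
Freezing every second free coordinate as well makes differences of values vanish, modulo `J`, on
every second block. These are the separating zeros, and `θ` becomes a coordinatewise map into the
Hilbert sum (`exists_coordinatewise_reduction`). -/

noncomputable section

/-! ### The quadratic variation of a sequence -/

/-- The quadratic variation of a real sequence: the supremum of `∑ (a (n i) - a (n (i + 1)))²` over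
all finite monotone chains `n 0 ≤ n 1 ≤ ⋯ ≤ n m`. -/
def sqVar (a : ℕ → ℝ) : ℝ≥0∞ :=
  ⨆ (m : ℕ) (n : ℕ →o ℕ), ∑ i ∈ Finset.range m, ENNReal.ofReal ((a (n i) - a (n (i + 1))) ^ 2)

theorem sum_le_sqVar (a : ℕ → ℝ) (m : ℕ) {n : ℕ → ℕ} (hn : Monotone n) :
    ∑ i ∈ Finset.range m, ENNReal.ofReal ((a (n i) - a (n (i + 1))) ^ 2) ≤ sqVar a :=
  le_iSup₂ (f := fun (m : ℕ) (n : ℕ →o ℕ) =>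
    ∑ i ∈ Finset.range m, ENNReal.ofReal ((a (n i) - a (n (i + 1))) ^ 2)) m ⟨n, hn⟩

theorem sqVar_comp_le (a : ℕ → ℝ) {f : ℕ → ℕ} (hf : Monotone f) : sqVar (a ∘ f) ≤ sqVar a :=
  iSup₂_le fun m n => sum_le_sqVar a m (hf.comp n.monotone)

theorem sq_sub_le_sqVar (a : ℕ → ℝ) (k l : ℕ) : ENNReal.ofReal ((a k - a l) ^ 2) ≤ sqVar a := by
  wlog h : k ≤ l generalizing k l
  · rw [← neg_sub, neg_sq]
    exact this l k (le_of_not_ge h)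
  have hn : Monotone fun i => if i = 0 then k else l := by
    intro i j hij
    dsimp only
    split_ifs <;> omega
  simpa using sum_le_sqVar a 1 hn

theorem sq_le_sqVar (a : ℕ → ℝ) (k : ℕ) {l : ℕ} (hl : a l = 0) :
    ENNReal.ofReal (a k ^ 2) ≤ sqVar a := by
  simpa [hl] using sq_sub_le_sqVar a k l

theorem sqVar_add_le (a b : ℕ → ℝ) : sqVar (a + b) ≤ 2 * sqVar a + 2 * sqVar b := by
  refine iSup₂_le fun m n => ?_
  calc ∑ i ∈ Finset.range m, ENNReal.ofReal (((a + b) (n i) - (a + b) (n (i + 1))) ^ 2)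
      ≤ ∑ i ∈ Finset.range m, (2 * ENNReal.ofReal ((a (n i) - a (n (i + 1))) ^ 2)
          + 2 * ENNReal.ofReal ((b (n i) - b (n (i + 1))) ^ 2)) := by
        refine Finset.sum_le_sum fun i _ => ?_
        rw [← ENNReal.ofReal_ofNat 2, ← ENNReal.ofReal_mul (by norm_num),
          ← ENNReal.ofReal_mul (by norm_num), ← ENNReal.ofReal_add (by positivity) (by positivity)]
        refine ENNReal.ofReal_le_ofReal ?_
        simp only [Pi.add_apply]
        nlinarith [sq_nonneg ((a (n i) - a (n (i + 1))) - (b (n i) - b (n (i + 1))))]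
    _ ≤ 2 * sqVar a + 2 * sqVar b := by
        rw [Finset.sum_add_distrib, ← Finset.mul_sum, ← Finset.mul_sum]
        gcongr
        · exact sum_le_sqVar a m n.monotone
        · exact sum_le_sqVar b m n.monotone

theorem sqVar_neg (a : ℕ → ℝ) : sqVar (-a) = sqVar a := by
  have h (x y : ℝ) : (-x - -y) ^ 2 = (x - y) ^ 2 := by ring
  simp only [sqVar, Pi.neg_apply, h]

theorem sqVar_sub_le (a b : ℕ → ℝ) : sqVar (a - b) ≤ 2 * sqVar a + 2 * sqVar b := by
  rw [sub_eq_add_neg, ← sqVar_neg b]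
  exact sqVar_add_le a (-b)

theorem sqVar_zero : sqVar 0 = 0 := by
  simp [sqVar]

/-- Each chain sum is continuous for the product topology, so `sqVar` is lower semicontinuous. This
is what lets stability pass to closures in the Baire argument. -/
theorem isClosed_sqVar_le (c : ℝ≥0∞) : IsClosed {a : ℕ → ℝ | sqVar a ≤ c} := by
  simp only [sqVar, iSup_le_iff, Set.ofPred_forall]
  refine isClosed_iInter fun m => isClosed_iInter fun n => isClosed_le ?_ continuous_const
  exact continuous_finsetSum _ fun i _ => ENNReal.continuous_ofReal.comp (by fun_prop)

/-- Disjointly supported sequences satisfy an upper `2`-estimate. -/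
theorem sqVar_le_two_mul_tsum {a : ℕ → ℝ} {b : ℕ → ℕ → ℝ}
    (h : ∀ n, ∃ j, b j n = a n ∧ ∀ i, i ≠ j → b i n = 0) :
    sqVar a ≤ 2 * ∑' j, sqVar (b j) := by
  have key (k l : ℕ) : ENNReal.ofReal ((a k - a l) ^ 2)
      ≤ 2 * ∑' j, ENNReal.ofReal ((b j k - b j l) ^ 2) := by
    obtain ⟨i, hi, hi'⟩ := h k
    obtain ⟨j, hj, hj'⟩ := h l
    rcases eq_or_ne i j with rfl | hij
    · rw [← hi, ← hj]
      refine (ENNReal.le_tsum (f := fun j => ENNReal.ofReal ((b j k - b j l) ^ 2)) i).trans ?_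
      exact le_mul_of_one_le_left zero_le one_le_two
    -- Here `b i` vanishes at `l` and `b j` at `k`, so the two cross differences are `a k` and `-a
    -- l`.
    · calc ENNReal.ofReal ((a k - a l) ^ 2)
          ≤ 2 * ∑ s ∈ {i, j}, ENNReal.ofReal ((b s k - b s l) ^ 2) := by
            rw [Finset.sum_pair hij, hi, hj, hi' j hij.symm, hj' i hij,
              ← ENNReal.ofReal_add (by positivity) (by positivity), ← ENNReal.ofReal_ofNat 2,
              ← ENNReal.ofReal_mul (by norm_num)]
            refine ENNReal.ofReal_le_ofReal ?_
            nlinarith [sq_nonneg (a k + a l)]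
        _ ≤ _ := by
            gcongr
            exact ENNReal.sum_le_tsum _
  refine iSup₂_le fun m n => ?_
  calc ∑ i ∈ Finset.range m, ENNReal.ofReal ((a (n i) - a (n (i + 1))) ^ 2)
      ≤ ∑ i ∈ Finset.range m, 2 * ∑' j, ENNReal.ofReal ((b j (n i) - b j (n (i + 1))) ^ 2) :=
        Finset.sum_le_sum fun i _ => key _ _
    _ = 2 * ∑' j, ∑ i ∈ Finset.range m, ENNReal.ofReal ((b j (n i) - b j (n (i + 1))) ^ 2) := by
        rw [← Finset.mul_sum, Summable.tsum_finsetSum fun _ _ => ENNReal.summable]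
    _ ≤ _ := by
        gcongr with j
        exact sum_le_sqVar (b j) m n.monotone

/-- Quadratic variations over consecutive ranges of indices are superadditive. -/
theorem sqVar_comp_add_le (a : ℕ → ℝ) {f g : ℕ → ℕ} (hf : Monotone f) (hg : Monotone g)
    (hfg : ∀ i j, f i ≤ g j) : sqVar (a ∘ f) + sqVar (a ∘ g) ≤ sqVar a := by
  unfold sqVar
  simp_rw [iSup_prod']
  refine ENNReal.iSup_add_iSup_le ?_
  rintro ⟨m, n⟩ ⟨m', n'⟩
  -- The first chain followed by the second; the term joining them is nonnegative and is dropped.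
  have hN : Monotone fun i => if i ≤ m then f (n i) else g (n' (i - (m + 1))) := by
    intro i j hij
    dsimp only
    split_ifs with h1 h2
    · exact hf (n.monotone hij)
    · exact hfg _ _
    · omega
    · exact hg (n'.monotone (by omega))
  have hle := sum_le_sqVar a (m + 1 + m') hN
  simp only [sqVar, iSup_prod'] at hle
  refine le_trans ?_ hle
  simp only [Finset.sum_range_add, Finset.sum_range_succ]
  refine add_le_add (le_trans (Finset.sum_le_sum fun i hi => ?_) le_self_add)
    (Finset.sum_le_sum fun i _ => ?_)
  · have hi := Finset.mem_range.1 hi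
    have h1 : i ≤ m := hi.le
    simp [h1, Nat.succ_le_of_lt hi]
  · have h1 : ¬ m + 1 + i ≤ m := by omega
    have h2 : ¬ m + 1 + i + 1 ≤ m := by omega
    have h3 : m + 1 + i + 1 - (m + 1) = i + 1 := by omega
    rw [if_neg h1, if_neg h2, h3, Nat.add_sub_cancel_left]
    exact le_rfl

/-- A step function has at most one jump. -/
theorem sqVar_step_le (c : ℝ) (l : ℕ) :
    sqVar (fun n => if n < l then c else 0) ≤ ENNReal.ofReal (c ^ 2) := by
  refine iSup₂_le fun m n => ?_
  -- The induction needs the sharper claim that nothing has accumulated before the chain passes `l`.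
  suffices h : ∑ i ∈ Finset.range m, ENNReal.ofReal (((if n i < l then c else 0)
      - (if n (i + 1) < l then c else 0)) ^ 2) ≤ if n m < l then 0 else ENNReal.ofReal (c ^ 2) by
    refine h.trans ?_
    split_ifs <;> simp
  induction m with
  | zero => simp
  | succ m ih =>
    rw [Finset.sum_range_succ]
    have hmono : n m ≤ n (m + 1) := n.monotone (Nat.le_succ m)
    by_cases h1 : n m < l <;> by_cases h2 : n (m + 1) < l
    · simpa [h1, h2] using ih
    · rw [if_pos h1, nonpos_iff_eq_zero] at ih
      simp [h1, h2, ih]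
    · omega
    · simpa [h1, h2] using ih

/-! ### Tails, truncations and blocks -/

/-- The sequence `a` with its first `l` terms replaced by `0`. -/
def seqTail (l : ℕ) (a : ℕ → ℝ) : ℕ → ℝ := fun n => if n < l then 0 else a n

/-- The first `l` terms of `a`, followed by zeros. -/
def seqTrunc (l : ℕ) (a : ℕ → ℝ) : ℕ → ℝ := fun n => if n < l then a n else 0

/-- The restriction of `a` to the `j`-th interval `[z j, z (j + 1))`. -/
def seqBlock (z : ℕ → ℕ) (j : ℕ) (a : ℕ → ℝ) : ℕ → ℝ :=
  fun n => if z j ≤ n ∧ n < z (j + 1) then a n else 0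

theorem seqBlock_eq_tail_sub {z : ℕ → ℕ} (hz : Monotone z) (j : ℕ) (a : ℕ → ℝ) :
    seqBlock z j a = seqTail (z j) a - seqTail (z (j + 1)) a := by
  ext n
  have := hz (show j ≤ j + 1 by omega)
  by_cases h1 : n < z j
  · have h2 : n < z (j + 1) := by omega
    simp [seqBlock, seqTail, h1, h2]
  · by_cases h2 : n < z (j + 1) <;> simp [seqBlock, seqTail, h1, h2, not_lt.1 h1]

theorem seqBlock_eq_trunc_sub {z : ℕ → ℕ} (hz : Monotone z) (j : ℕ) (a : ℕ → ℝ) :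
    seqBlock z j a = seqTrunc (z (j + 1)) a - seqTrunc (z j) a := by
  ext n
  have := hz (show j ≤ j + 1 by omega)
  by_cases h1 : n < z j
  · have h2 : n < z (j + 1) := by omega
    simp [seqBlock, seqTrunc, h1, h2]
  · by_cases h2 : n < z (j + 1) <;> simp [seqBlock, seqTrunc, h1, h2, not_lt.1 h1]

theorem seqBlock_add (z : ℕ → ℕ) (j : ℕ) (a b : ℕ → ℝ) :
    seqBlock z j (a + b) = seqBlock z j a + seqBlock z j b := by
  ext n
  simp only [seqBlock, Pi.add_apply]
  split_ifs <;> simp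

theorem seqBlock_sub (z : ℕ → ℕ) (j : ℕ) (a b : ℕ → ℝ) :
    seqBlock z j (a - b) = seqBlock z j a - seqBlock z j b := by
  ext n
  simp only [seqBlock, Pi.sub_apply]
  split_ifs <;> simp

theorem sqVar_single_le (c : ℝ) (j : ℕ) :
    sqVar (Pi.single j c) ≤ 4 * ENNReal.ofReal (c ^ 2) := by
  have h : (Pi.single j c : ℕ → ℝ)
      = (fun n => if n < j + 1 then c else 0) - fun n => if n < j then c else 0 := by
    ext n
    rcases lt_trichotomy n j with h | rfl | h
    · simp [h, h.ne, h.le]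
    · simp
    · simp [h.ne', h.not_gt, h.not_ge]
  rw [h]
  refine (sqVar_sub_le _ _).trans ?_
  refine (add_le_add (mul_le_mul_right (sqVar_step_le c (j + 1)) 2)
    (mul_le_mul_right (sqVar_step_le c j) 2)).trans (le_of_eq ?_)
  ring

/-- A crude bound in terms of finitely many coordinates. Its value is that the right side is
continuous for the product topology. -/
theorem sqVar_trunc_le (l : ℕ) (a : ℕ → ℝ) :
    sqVar (seqTrunc l a) ≤ 8 * ∑ j ∈ Finset.range l, ENNReal.ofReal (a j ^ 2) := by
  calc sqVar (seqTrunc l a)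
      ≤ 2 * ∑' j, sqVar (Pi.single j (seqTrunc l a j)) := by
        refine sqVar_le_two_mul_tsum fun n => ⟨n, by simp, fun i hi => ?_⟩
        simp [hi.symm]
    _ ≤ 2 * ∑' j, 4 * ENNReal.ofReal (seqTrunc l a j ^ 2) := by
        gcongr with j
        exact sqVar_single_le _ j
    _ = 8 * ∑' j, ENNReal.ofReal (seqTrunc l a j ^ 2) := by
        rw [ENNReal.tsum_mul_left, ← mul_assoc]
        norm_num
    _ = _ := by
        rw [tsum_eq_sum (s := Finset.range l)]
        · congr 1
          refine Finset.sum_congr rfl fun j hj => ?_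
          simp [seqTrunc, Finset.mem_range.1 hj]
        · intro j hj
          simp [seqTrunc, Finset.mem_range.not.1 hj]

/-- A nearly optimal chain uses up all but `ε` of the variation before its last index `l`;
superadditivity leaves at most `ε` beyond `l`. -/
theorem exists_sqVar_comp_max_le {a : ℕ → ℝ} (ha : sqVar a ≠ ∞) {ε : ℝ≥0∞} (hε : ε ≠ 0) :
    ∃ l, sqVar (a ∘ fun n => max n l) ≤ ε := by
  rcases eq_or_ne (sqVar a) 0 with h0 | h0
  · refine ⟨0, (sqVar_comp_le a fun i j h => max_le_max_right 0 h).trans ?_⟩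
    simp [h0]
  have hlt : sqVar a - ε < sqVar a := ENNReal.sub_lt_self ha h0 hε
  obtain ⟨m, hm⟩ := lt_iSup_iff.1 hlt
  obtain ⟨n, hn⟩ := lt_iSup_iff.1 hm
  refine ⟨n m, ?_⟩
  have h1 : sqVar a - ε ≤ sqVar (a ∘ fun i => min i (n m)) := by
    refine hn.le.trans (le_trans (Finset.sum_le_sum fun i hi => ?_) (sum_le_sqVar _ m n.monotone))
    have hi := Finset.mem_range.1 hi
    rw [Function.comp_apply, Function.comp_apply, min_eq_left (n.monotone hi.le),
      min_eq_left (n.monotone (Nat.succ_le_of_lt hi))]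
  have h2 := sqVar_comp_add_le a (f := fun i => min i (n m)) (g := fun i => max i (n m))
    (fun i j h => min_le_min_right _ h) (fun i j h => max_le_max_right _ h)
    (fun i j => (min_le_right _ _).trans (le_max_right _ _))
  have h3 : sqVar (a ∘ fun i => min i (n m)) ≠ ∞ :=
    ((sqVar_comp_le a fun i j h => min_le_min_right _ h).trans_lt ha.lt_top).ne
  have h4 : sqVar a ≤ sqVar (a ∘ fun i => min i (n m)) + ε := tsub_le_iff_right.1 h1
  exact (ENNReal.add_le_add_iff_left h3).1 (h2.trans h4)

/-- Cutting off at `l'` differs from holding the value `a l'` constant before `l'` by a single jump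
of height `a l'`. This jump is small because `a` is a null sequence. -/
theorem exists_forall_sqVar_tail_le {a : ℕ → ℝ} (ha : sqVar a ≠ ∞) (ha0 : Tendsto a atTop (𝓝 0))
    {ε : ℝ≥0∞} (hε : ε ≠ 0) : ∃ l, ∀ l' ≥ l, sqVar (seqTail l' a) ≤ ε := by
  have hε4 : ε / 4 ≠ 0 := by simp [hε]
  obtain ⟨l, hl⟩ := exists_sqVar_comp_max_le ha hε4
  have hlim : Tendsto (fun n => ENNReal.ofReal (a n ^ 2)) atTop (𝓝 0) := by
    simpa using ENNReal.tendsto_ofReal (ha0.pow 2)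
  obtain ⟨k, hk⟩ := (hlim.eventually (ge_mem_nhds (pos_iff_ne_zero.2 hε4))).exists_forall_of_atTop
  refine ⟨max l k, fun l' hl' => ?_⟩
  have h : seqTail l' a = (a ∘ fun n => max n l') - fun n => if n < l' then a l' else 0 := by
    ext n
    by_cases h : n < l'
    · simp [seqTail, h, h.le]
    · simp [seqTail, h, not_lt.1 h]
  have h1 : sqVar (a ∘ fun n => max n l') ≤ ε / 4 := by
    have : (a ∘ fun n => max n l') = (a ∘ fun n => max n l) ∘ fun n => max n l' := by
      ext n
      simp only [Function.comp_apply]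
      congr 1
      omega
    rw [this]
    exact (sqVar_comp_le _ fun i j h => max_le_max_right _ h).trans hl
  have h2 := (sqVar_step_le (a l') l').trans (hk l' (by omega))
  rw [h]
  refine (sqVar_sub_le _ _).trans ((add_le_add (mul_le_mul_right h1 2)
    (mul_le_mul_right h2 2)).trans (le_of_eq ?_))
  rw [← add_mul, show (2 : ℝ≥0∞) + 2 = 4 by norm_num]
  exact ENNReal.mul_div_cancel (by norm_num) (by norm_num)

/-- Because `a` vanishes at both ends of a block, the block is `a` composed with the clamping of
indices to that interval, and superadditivity applies with constant 1. -/
theorem tsum_sqVar_block_le {z : ℕ → ℕ} (hz : Monotone z) {a : ℕ → ℝ} (h0 : ∀ j, a (z j) = 0) :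
    ∑' j, sqVar (seqBlock z j a) ≤ sqVar a := by
  have hmono (s t : ℕ) : Monotone fun n => max s (min n t) :=
    fun i j h => max_le_max_left s (min_le_min_right t h)
  have hblock (j : ℕ) : seqBlock z j a = a ∘ fun n => max (z j) (min n (z (j + 1))) := by
    ext n
    have := hz (show j ≤ j + 1 by omega)
    simp only [seqBlock, Function.comp_apply]
    split_ifs with h
    · rw [min_eq_left h.2.le, max_eq_right h.1]
    · rcases lt_or_ge n (z j) with h1 | h1
      · rw [max_eq_left (by omega), h0]
      · rw [max_eq_right (by omega), min_eq_right (by omega), h0]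
  have hsum (K : ℕ) : ∑ j ∈ Finset.range K, sqVar (seqBlock z j a)
      ≤ sqVar (a ∘ fun n => max (z 0) (min n (z K))) := by
    induction K with
    | zero => simp
    | succ K ih =>
      rw [Finset.sum_range_succ]
      refine (add_le_add ih (congrArg sqVar (hblock K)).le).trans ?_
      have hK := hz (show K ≤ K + 1 by omega)
      have h0K := hz (Nat.zero_le K)
      have key := sqVar_comp_add_le (a ∘ fun n => max (z 0) (min n (z (K + 1))))
        (hmono (z 0) (z K)) (hmono (z K) (z (K + 1)))
        (fun i j => (max_le h0K (min_le_right _ _)).trans (le_max_left _ _))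
      convert key using 3 <;> ext n <;> simp only [Function.comp_apply] <;> congr 1 <;> omega
  exact ENNReal.tsum_le_of_sum_range_le fun K => (hsum K).trans (sqVar_comp_le a (hmono _ _))

theorem exists_mem_block {z : ℕ → ℕ} (hz : StrictMono z) (h0 : z 0 = 0) (n : ℕ) :
    ∃ j, z j ≤ n ∧ n < z (j + 1) := by
  have hex : ∃ j, n < z j := ⟨n + 1, (Nat.lt_succ_self n).trans_le (hz.le_apply)⟩
  classical
  have hpos : Nat.find hex ≠ 0 := fun h => by
    have := Nat.find_spec hex
    rw [h, h0] at this
    omega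
  obtain ⟨j, hj⟩ := Nat.exists_eq_succ_of_ne_zero hpos
  refine ⟨j, not_lt.1 (Nat.find_min hex (by omega)), ?_⟩
  have := Nat.find_spec hex
  rwa [hj] at this

theorem block_unique {z : ℕ → ℕ} (hz : StrictMono z) {n i j : ℕ} (hi : z i ≤ n ∧ n < z (i + 1))
    (hj : z j ≤ n ∧ n < z (j + 1)) : i = j := by
  have h1 : i < j + 1 := hz.lt_iff_lt.1 (hi.1.trans_lt hj.2)
  have h2 : j < i + 1 := hz.lt_iff_lt.1 (hj.1.trans_lt hi.2)
  omega

theorem sqVar_le_two_mul_tsum_block {z : ℕ → ℕ} (hz : StrictMono z) (h0 : z 0 = 0) (a : ℕ → ℝ) :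
    sqVar a ≤ 2 * ∑' j, sqVar (seqBlock z j a) := by
  refine sqVar_le_two_mul_tsum fun n => ?_
  obtain ⟨j, hj⟩ := exists_mem_block hz h0 n
  refine ⟨j, if_pos hj, fun i hi => if_neg fun h => hi (block_unique hz h hj)⟩

theorem tendsto_zero_of_tsum_block {z : ℕ → ℕ} (hz : StrictMono z) (h0 : z 0 = 0) {a : ℕ → ℝ}
    (h : ∑' j, sqVar (seqBlock z j a) ≠ ∞) : Tendsto a atTop (𝓝 0) := by
  have hlim := ENNReal.tendsto_atTop_zero_of_tsum_ne_top h
  rw [Metric.tendsto_atTop]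
  intro ε hε
  obtain ⟨J, hJ⟩ := (hlim.eventually (gt_mem_nhds
    (ENNReal.ofReal_pos.2 (pow_pos hε 2)))).exists_forall_of_atTop
  refine ⟨z J, fun n hn => ?_⟩
  obtain ⟨j, hj⟩ := exists_mem_block hz h0 n
  have hJj : J < j + 1 := hz.lt_iff_lt.1 (hn.trans_lt hj.2)
  have h1 : seqBlock z j a n = a n := if_pos hj
  have h2 : seqBlock z j a (z (j + 1)) = 0 := if_neg (by simp)
  have h3 := (sq_le_sqVar (seqBlock z j a) n h2).trans_lt (hJ j (by omega))
  rw [h1, ENNReal.ofReal_lt_ofReal_iff (pow_pos hε 2)] at h3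
  rw [Real.dist_eq, sub_zero]
  exact abs_lt_of_sq_lt_sq h3 hε.le

/-! ### Comparison with the norm of James' space -/

/-- Repetitions in a monotone chain contribute nothing and can be deleted. The James norm only
admits strictly increasing chains. -/
theorem exists_strictMono_chain (a : ℕ → ℝ) {n : ℕ → ℕ} (hn : Monotone n) (m : ℕ) :
    ∃ (p : ℕ) (f : ℕ → ℕ), StrictMono f ∧ f p = n m ∧
      ∑ i ∈ Finset.range m, (a (n i) - a (n (i + 1))) ^ 2
        = ∑ i ∈ Finset.range p, (a (f i) - a (f (i + 1))) ^ 2 := by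
  induction m with
  | zero => exact ⟨0, fun i => n 0 + i, fun i j h => by simpa using h, by simp, by simp⟩
  | succ m ih =>
    obtain ⟨p, f, hf, hfp, hsum⟩ := ih
    rcases (hn (show m ≤ m + 1 by omega)).eq_or_lt with h | h
    · exact ⟨p, f, hf, hfp.trans h, by rw [Finset.sum_range_succ, hsum, h]; simp⟩
    · refine ⟨p + 1, fun i => if i ≤ p then f i else n (m + 1) + (i - (p + 1)), ?_, by simp, ?_⟩
      · intro i j hij
        dsimp only
        split_ifs with h1 h2
        · exact hf hij
        · have := hf.monotone h1
          omega
        · omega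
        · omega
      · rw [Finset.sum_range_succ, Finset.sum_range_succ, hsum]
        congr 1
        · refine Finset.sum_congr rfl fun i hi => ?_
          have hi := Finset.mem_range.1 hi
          simp [hi.le, Nat.succ_le_of_lt hi]
        · simp [hfp]

theorem ofReal_sqrt_div_sqrt_two_sq {s : ℝ} (hs : 0 ≤ s) :
    ENNReal.ofReal (√s / √2) ^ 2 = ENNReal.ofReal (s / 2) := by
  rw [← ENNReal.ofReal_pow (by positivity), div_pow, Real.sq_sqrt hs, Real.sq_sqrt (by norm_num)]

theorem sum_cyclic_eq (a : ℕ → ℝ) (m : ℕ) (f : ℕ → ℕ) :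
    ∑ i : Fin (m + 1), (a (f (i : ℕ)) - a (f ((i + 1 : Fin (m + 1)) : ℕ))) ^ 2
      = ∑ i ∈ Finset.range m, (a (f i) - a (f (i + 1))) ^ 2 + (a (f m) - a (f 0)) ^ 2 := by
  rw [Fin.sum_univ_castSucc, Finset.sum_range]
  simp

theorem sqVar_le_two_mul_jamesENorm_sq (a : ℕ → ℝ) : sqVar a ≤ 2 * jamesENorm a ^ 2 := by
  refine iSup₂_le fun m n => ?_
  obtain ⟨p, f, hf, -, hsum⟩ := exists_strictMono_chain a n.monotone m
  let F : Fin (p + 1) ↪o ℕ := OrderEmbedding.ofStrictMono (fun i => f i) fun i j h => hf h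
  have h1 : ENNReal.ofReal (√(∑ i : Fin (p + 1), (a (F i) - a (F (i + 1))) ^ 2) / √2)
      ≤ jamesENorm a := le_iSup₂ (f := fun (m : ℕ) (n : Fin (m + 1) ↪o ℕ) =>
        ENNReal.ofReal (√(∑ i : Fin (m + 1), (a (n i) - a (n (i + 1))) ^ 2) / √2)) p F
  have h2 := pow_le_pow_left₀ zero_le h1 2
  rw [ofReal_sqrt_div_sqrt_two_sq (Finset.sum_nonneg fun _ _ => sq_nonneg _)] at h2
  rw [← ENNReal.ofReal_sum_of_nonneg fun _ _ => sq_nonneg _, hsum]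
  refine le_trans ?_ (mul_le_mul_right h2 2)
  rw [← ENNReal.ofReal_ofNat 2, ← ENNReal.ofReal_mul (by norm_num)]
  refine ENNReal.ofReal_le_ofReal ?_
  have h3 := sum_cyclic_eq a p f
  have h4 : ∑ i : Fin (p + 1), (a (F i) - a (F (i + 1))) ^ 2
    = ∑ i : Fin (p + 1), (a (f (i : ℕ)) - a (f ((i + 1 : Fin (p + 1)) : ℕ))) ^ 2 := rfl
  rw [h4, h3]
  have := sq_nonneg (a (f p) - a (f 0))
  linarith

/-- The term closing the cycle is itself the variation of a one-step chain; the resulting factor 2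
cancels the factor `1 / √2` in the norm. -/
theorem jamesENorm_sq_le_sqVar (a : ℕ → ℝ) : jamesENorm a ^ 2 ≤ sqVar a := by
  simp only [jamesENorm, ENNReal.iSup_pow_of_ne_zero two_ne_zero]
  refine iSup₂_le fun m n => ?_
  let f : ℕ → ℕ := fun i => if h : i < m + 1 then n ⟨i, h⟩ else n (Fin.last m)
  have hf : Monotone f := by
    intro i j hij
    simp only [f]
    split_ifs with h1 h2
    · exact n.monotone hij
    · exact n.monotone (Fin.le_last _)
    · omega
    · exact le_rfl
  have hfn (i : Fin (m + 1)) : n i = f i := by simp only [f, dif_pos i.isLt]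
  rw [ofReal_sqrt_div_sqrt_two_sq (Finset.sum_nonneg fun _ _ => sq_nonneg _)]
  simp only [hfn]
  rw [sum_cyclic_eq]
  have h1 := sum_le_sqVar a m hf
  have h2 := sq_sub_le_sqVar a (f m) (f 0)
  rw [← ENNReal.ofReal_sum_of_nonneg fun _ _ => sq_nonneg _] at h1
  rw [ENNReal.ofReal_div_of_pos two_pos, ENNReal.ofReal_add
    (Finset.sum_nonneg fun _ _ => sq_nonneg _) (sq_nonneg _)]
  refine ENNReal.div_le_of_le_mul ?_
  rw [ENNReal.ofReal_ofNat, mul_two]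
  exact add_le_add h1 h2

theorem mem_jamesSpace_iff (a : ℕ → ℝ) :
    a ∈ jamesSpace ↔ Tendsto a atTop (𝓝 0) ∧ sqVar a ≠ ∞ := by
  refine and_congr_right fun _ => ⟨fun h => ?_, fun h => ?_⟩
  · refine ((sqVar_le_two_mul_jamesENorm_sq a).trans_lt ?_).ne
    exact ENNReal.mul_lt_top (by simp) (ENNReal.pow_lt_top h)
  · have := (jamesENorm_sq_le_sqVar a).trans_lt h.lt_top
    exact (ENNReal.pow_lt_top_iff.1 this).resolve_right (by norm_num)

theorem mem_jamesSpace_of_tsum_block {z : ℕ → ℕ} (hz : StrictMono z) (h0 : z 0 = 0) {a : ℕ → ℝ}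
    (h : ∑' j, sqVar (seqBlock z j a) ≠ ∞) : a ∈ jamesSpace := by
  refine (mem_jamesSpace_iff a).2 ⟨tendsto_zero_of_tsum_block hz h0 h, ?_⟩
  exact ((sqVar_le_two_mul_tsum_block hz h0 a).trans_lt
    (ENNReal.mul_lt_top (by simp) h.lt_top)).ne

/-! ### The decomposition relation of the Hilbert sum -/

theorem BorelReducible.trans {α β γ : Type*} [TopologicalSpace α] [TopologicalSpace β]
    [TopologicalSpace γ] {E : Setoid α} {F : Setoid β} {G : Setoid γ} (h : BorelReducible E F)
    (h' : BorelReducible F G) : BorelReducible E G := by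
  obtain ⟨θ, hθ, hE⟩ := h
  obtain ⟨η, hη, hF⟩ := h'
  exact ⟨η ∘ θ, @Measurable.comp _ _ _ (borel α) (borel β) (borel γ) _ _ hη hθ,
    fun x y => (hE x y).trans (hF _ _)⟩

theorem padZero_sub {n : ℕ} (r s : JamesFin n) : padZero (r - s) = padZero r - padZero s := by
  rw [eq_sub_iff_add_eq, ← padZero_add, sub_add_cancel]

namespace JamesFin

theorem ofReal_norm {n : ℕ} (r : JamesFin n) : ENNReal.ofReal ‖r‖ = jamesENorm (padZero r) := by
  rw [norm_def, ENNReal.ofReal_toReal (jamesENorm_padZero_lt_top r).ne]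

theorem sqVar_padZero_le {n : ℕ} (r : JamesFin n) :
    sqVar (padZero r) ≤ 2 * ENNReal.ofReal (‖r‖ ^ 2) := by
  rw [ENNReal.ofReal_pow (norm_nonneg r), ofReal_norm]
  exact sqVar_le_two_mul_jamesENorm_sq _

theorem ofReal_norm_sq_le {n : ℕ} (r : JamesFin n) :
    ENNReal.ofReal (‖r‖ ^ 2) ≤ sqVar (padZero r) := by
  rw [ENNReal.ofReal_pow (norm_nonneg r), ofReal_norm]
  exact jamesENorm_sq_le_sqVar _

theorem abs_padZero_le_norm {n : ℕ} (r : JamesFin n) (i : ℕ) : |padZero r i| ≤ ‖r‖ := by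
  have h := abs_sub_le_jamesENorm (padZero r) (show i < max n (i + 1) by omega)
  have h0 : padZero r (max n (i + 1)) = 0 := by simp [padZero]
  rw [h0, sub_zero, ← ofReal_norm] at h
  exact (ENNReal.ofReal_le_ofReal_iff (norm_nonneg r)).1 h

theorem summable_norm_sq_iff {ι : Type*} {n : ι → ℕ} (c : ∀ k, JamesFin (n k)) :
    Summable (fun k => ‖c k‖ ^ 2) ↔ ∑' k, sqVar (padZero (c k)) ≠ ∞ := by
  constructor
  · intro h
    refine (lt_of_le_of_lt (ENNReal.tsum_le_tsum fun k => sqVar_padZero_le (c k)) ?_).ne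
    rw [ENNReal.tsum_mul_left]
    exact ENNReal.mul_lt_top (by simp) h.tsum_ofReal_lt_top
  · intro h
    have h' : ∑' k, ENNReal.ofReal (‖c k‖ ^ 2) ≠ ∞ :=
      ((ENNReal.tsum_le_tsum fun k => ofReal_norm_sq_le (c k)).trans_lt h.lt_top).ne
    simpa [ENNReal.toReal_ofReal, sq_nonneg] using ENNReal.summable_toReal h'

end JamesFin

/-- The coordinates of a limit of the partial sums must be the `c k`, so convergence forces `c` to
be square summable; the converse is the usual expansion in an `ℓ₂`-sum. -/
theorem seriesConverges_single_iff (c : ∀ k : ℕ, JamesFin (k + 1)) :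
    SeriesConverges (fun k => (lp.single 2 k (c k) : JamesSum)) ↔
      ∑' k, sqVar (padZero (c k)) ≠ ∞ := by
  have hmem : Memℓp c 2 ↔ Summable (fun k => ‖c k‖ ^ 2) := by
    rw [memℓp_gen_iff (by norm_num)]
    simp
  rw [← JamesFin.summable_norm_sq_iff, ← hmem]
  constructor
  · rintro ⟨s, hs⟩
    suffices h : c = s by
      rw [h]
      exact lp.memℓp s
    ext j
    have h1 : Tendsto (fun N => (∑ n ∈ Finset.range N, (lp.single 2 n (c n) : JamesSum)) j) atTop
        (𝓝 (s j)) := by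
      have hc : Continuous fun f : JamesSum => f j :=
        (continuous_apply j).comp lp.uniformContinuous_coe.continuous
      exact (hc.tendsto s).comp hs
    refine tendsto_nhds_unique (tendsto_const_nhds.congr' ?_) h1
    filter_upwards [eventually_gt_atTop j] with N hN
    rw [lp.coeFn_sum, Finset.sum_apply, Finset.sum_eq_single j]
    · simp
    · intro b _ hb
      rw [lp.single_apply_ne _ _ _ hb.symm]
    · intro h
      exact absurd (Finset.mem_range.2 hN) h
  · intro h
    exact ⟨⟨c, h⟩, (lp.hasSum_single (by simp) (⟨c, h⟩ : JamesSum)).tendsto_sum_nat⟩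

theorem jamesSummand_eq_single {k : ℕ} (s : jamesSummand k) :
    (s : JamesSum) = lp.single 2 k ((s : JamesSum) k) := by
  obtain ⟨r, hr⟩ := s.2
  rw [← hr]
  simp

theorem decompositionSetoid_iff (α β : ∀ k, jamesSummand k) :
    decompositionSetoid jamesSummand α β ↔
      ∑' k, sqVar (padZero ((α k : JamesSum) k - (β k : JamesSum) k)) ≠ ∞ := by
  rw [← seriesConverges_single_iff]
  change SeriesConverges (fun n => (α n : JamesSum) - (β n : JamesSum)) ↔ _
  simp_rw [lp.single_sub, ← jamesSummand_eq_single]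

/-! ### Concatenation with separating zeros -/

/-- The left end points of consecutive intervals of lengths `2, 3, 4, …`. -/
def sepPos (k : ℕ) : ℕ := ∑ i ∈ Finset.range k, (i + 2)

theorem sepPos_zero : sepPos 0 = 0 := rfl

theorem sepPos_succ (k : ℕ) : sepPos (k + 1) = sepPos k + (k + 2) :=
  Finset.sum_range_succ _ _

theorem sepPos_strictMono : StrictMono sepPos :=
  strictMono_nat_of_lt_succ fun k => by rw [sepPos_succ]; omega

/-- The index of the interval which contains `n`. -/
def sepIndex (n : ℕ) : ℕ := (exists_mem_block sepPos_strictMono sepPos_zero n).choose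

theorem sepIndex_eq {n j : ℕ} (h : sepPos j ≤ n ∧ n < sepPos (j + 1)) : sepIndex n = j :=
  block_unique sepPos_strictMono
    (exists_mem_block sepPos_strictMono sepPos_zero n).choose_spec h

/-- The concatenation of finite sequences of lengths `1, 2, 3, …`, each preceded by a zero. -/
def concat (c : ∀ k : ℕ, JamesFin (k + 1)) (n : ℕ) : ℝ :=
  if n ≤ sepPos (sepIndex n) then 0
  else padZero (c (sepIndex n)) (n - (sepPos (sepIndex n) + 1))

theorem concat_sub (c d : ∀ k : ℕ, JamesFin (k + 1)) :
    concat c - concat d = concat fun k => c k - d k := by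
  ext n
  simp only [concat, Pi.sub_apply, padZero_sub]
  split_ifs <;> simp

theorem concat_sepPos (c : ∀ k : ℕ, JamesFin (k + 1)) (j : ℕ) : concat c (sepPos j) = 0 :=
  if_pos (by rw [sepIndex_eq ⟨le_rfl, sepPos_strictMono (Nat.lt_succ_self j)⟩])

theorem concat_apply (c : ∀ k : ℕ, JamesFin (k + 1)) {j n : ℕ} (h1 : sepPos j < n)
    (h2 : n < sepPos (j + 1)) : concat c n = padZero (c j) (n - (sepPos j + 1)) := by
  have h := sepIndex_eq ⟨h1.le, h2⟩
  rw [concat, h, if_neg (not_le.2 h1)]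

theorem sqVar_padZero_le_block (c : ∀ k : ℕ, JamesFin (k + 1)) (j : ℕ) :
    sqVar (padZero (c j)) ≤ sqVar (seqBlock sepPos j (concat c)) := by
  have h : padZero (c j) = seqBlock sepPos j (concat c) ∘ fun n => n + (sepPos j + 1) := by
    ext n
    have hs := sepPos_succ j
    simp only [Function.comp_apply, seqBlock]
    split_ifs with h
    · rw [concat_apply c (by omega) h.2, Nat.add_sub_cancel]
    · have : ¬ n < j + 1 := by omega
      simp [padZero, this]
  rw [h]
  exact sqVar_comp_le _ fun i j h => Nat.add_le_add_right h _

theorem sqVar_block_concat_le (c : ∀ k : ℕ, JamesFin (k + 1)) (j : ℕ) :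
    sqVar (seqBlock sepPos j (concat c)) ≤ 4 * sqVar (padZero (c j)) := by
  -- Truncated subtraction repeats the first entry to the left of the block; a step function removes
  -- it there, including at the separating zero.
  have h : seqBlock sepPos j (concat c) = (padZero (c j) ∘ fun n => n - (sepPos j + 1))
      - fun n => if n < sepPos j + 1 then padZero (c j) 0 else 0 := by
    ext n
    have hs := sepPos_succ j
    simp only [Function.comp_apply, seqBlock, Pi.sub_apply]
    by_cases h1 : n < sepPos j + 1
    · rw [if_pos h1, Nat.sub_eq_zero_of_le h1.le, sub_self, ite_eq_right_iff]
      intro h2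
      rw [show n = sepPos j by omega, concat_sepPos]
    · rw [if_neg h1, sub_zero]
      split_ifs with h2
      · exact concat_apply c (by omega) h2.2
      · have : ¬ n - (sepPos j + 1) < j + 1 := by omega
        simp [padZero, this]
  have h0 : padZero (c j) (j + 1) = 0 := by simp [padZero]
  rw [h]
  refine (sqVar_sub_le _ _).trans ?_
  have h1 : sqVar (padZero (c j) ∘ fun n => n - (sepPos j + 1)) ≤ sqVar (padZero (c j)) :=
    sqVar_comp_le _ fun i j h => Nat.sub_le_sub_right h _
  have h2 := (sqVar_step_le (padZero (c j) 0) (sepPos j + 1)).trans (sq_le_sqVar _ 0 h0)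
  refine (add_le_add (mul_le_mul_right h1 2) (mul_le_mul_right h2 2)).trans (le_of_eq ?_)
  ring

theorem concat_mem_jamesSpace_iff (c : ∀ k : ℕ, JamesFin (k + 1)) :
    concat c ∈ jamesSpace ↔ ∑' k, sqVar (padZero (c k)) ≠ ∞ := by
  constructor
  · intro h
    refine (((ENNReal.tsum_le_tsum (sqVar_padZero_le_block c)).trans (tsum_sqVar_block_le
      sepPos_strictMono.monotone (concat_sepPos c))).trans_lt ?_).ne
    exact ((mem_jamesSpace_iff _).1 h).2.lt_top
  · intro h
    refine mem_jamesSpace_of_tsum_block sepPos_strictMono sepPos_zero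
      ((ENNReal.tsum_le_tsum (sqVar_block_concat_le c)).trans_lt ?_).ne
    rw [ENNReal.tsum_mul_left]
    exact ENNReal.mul_lt_top (by simp) h.lt_top

theorem continuous_padZero_apply (k i : ℕ) :
    Continuous fun f : JamesSum => padZero (f k) i := by
  refine (LipschitzWith.of_dist_le_mul (K := 1) fun f g => ?_).continuous
  rw [NNReal.coe_one, one_mul, dist_eq_norm, dist_eq_norm, ← Pi.sub_apply, ← padZero_sub]
  exact (JamesFin.abs_padZero_le_norm _ i).trans (lp.norm_apply_le_norm two_ne_zero (f - g) k)

theorem borelReducible_decomposition_jamesSpace :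
    BorelReducible (decompositionSetoid jamesSummand) (sequenceSetoid jamesSpace) := by
  refine ⟨fun α => concat fun k => (α k : JamesSum) k, ?_, fun α β => ?_⟩
  · refine Continuous.borel_measurable (continuous_pi fun n => ?_)
    unfold concat
    split_ifs
    · exact continuous_const
    · exact (continuous_padZero_apply _ _).comp
        (continuous_subtype_val.comp (continuous_apply (sepIndex n)))
  · rw [decompositionSetoid_iff, ← concat_mem_jamesSpace_iff, ← concat_sub]
    rfl

/-! ### Coordinate functionals of a Schauder basis -/

theorem SeriesConvergesTo.unique {X : Type*} [NormedAddCommGroup X] {u : ℕ → X} {s t : X}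
    (hs : SeriesConvergesTo u s) (ht : SeriesConvergesTo u t) : s = t :=
  tendsto_nhds_unique hs ht

section Basis

variable {X : Type*} [NormedAddCommGroup X] [NormedSpace ℝ X] {x : ℕ → X}

namespace IsSchauderBasis

/-- The coefficients of a vector with respect to a Schauder basis. -/
def coeff (hx : IsSchauderBasis x) (v : X) : ℕ → ℝ := (hx v).choose

theorem coeff_spec (hx : IsSchauderBasis x) (v : X) :
    SeriesConvergesTo (fun n => hx.coeff v n • x n) v :=
  (hx v).choose_spec.1

theorem coeff_eq (hx : IsSchauderBasis x) {v : X} {a : ℕ → ℝ}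
    (h : SeriesConvergesTo (fun n => a n • x n) v) : hx.coeff v = a :=
  (hx v).unique (hx.coeff_spec v) h

theorem seriesConvergesTo_single (x : ℕ → X) (m : ℕ) :
    SeriesConvergesTo (fun n => (Pi.single m 1 : ℕ → ℝ) n • x n) (x m) := by
  refine tendsto_const_nhds.congr' ?_
  filter_upwards [eventually_gt_atTop m] with N hN
  rw [Finset.sum_eq_single m]
  · simp
  · intro b _ hb
    simp [hb]
  · intro h
    exact absurd (Finset.mem_range.2 hN) h

theorem coeff_basis (hx : IsSchauderBasis x) (m : ℕ) : hx.coeff (x m) = Pi.single m 1 :=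
  hx.coeff_eq (seriesConvergesTo_single x m)

theorem ne_zero (hx : IsSchauderBasis x) (m : ℕ) : x m ≠ 0 := by
  intro h
  have h1 := hx.coeff_basis m
  have h2 : hx.coeff (x m) = 0 := hx.coeff_eq (by simp [SeriesConvergesTo, h])
  have h3 := congrFun (h1.symm.trans h2) m
  simp at h3

theorem coeff_add (hx : IsSchauderBasis x) (v w : X) :
    hx.coeff (v + w) = hx.coeff v + hx.coeff w := by
  refine hx.coeff_eq ?_
  simpa [SeriesConvergesTo, add_smul, Finset.sum_add_distrib] using
    Tendsto.add (hx.coeff_spec v) (hx.coeff_spec w)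

theorem coeff_smul (hx : IsSchauderBasis x) (c : ℝ) (v : X) :
    hx.coeff (c • v) = c • hx.coeff v := by
  refine hx.coeff_eq ?_
  simpa [SeriesConvergesTo, mul_smul, Finset.smul_sum] using
    Tendsto.const_smul (hx.coeff_spec v) c

end IsSchauderBasis

/-- The convergent sequences in `X`, with their limits, which are sequences of partial sums of
series `∑ a n • x n`. -/
def partialSumSpace (x : ℕ → X) : Submodule ℝ C(OnePoint ℕ, X) where
  carrier := {S | S ((0 : ℕ) : OnePoint ℕ) = 0 ∧
    ∀ n : ℕ, S ((n + 1 : ℕ) : OnePoint ℕ) - S (n : OnePoint ℕ) ∈ Submodule.span ℝ {x n}}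
  zero_mem' := by simp
  add_mem' := by
    rintro S T ⟨hS, hS'⟩ ⟨hT, hT'⟩
    refine ⟨by simp [hS, hT], fun n => ?_⟩
    simpa [add_sub_add_comm] using Submodule.add_mem _ (hS' n) (hT' n)
  smul_mem' := by
    rintro c S ⟨hS, hS'⟩
    refine ⟨by simp [hS], fun n => ?_⟩
    simpa [smul_sub] using Submodule.smul_mem _ c (hS' n)

theorem isClosed_partialSumSpace (x : ℕ → X) :
    IsClosed (partialSumSpace x : Set C(OnePoint ℕ, X)) := by
  have h (p : OnePoint ℕ) : Continuous fun S : C(OnePoint ℕ, X) => S p :=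
    continuous_eval_const p
  have heq : (partialSumSpace x : Set C(OnePoint ℕ, X)) =
      {S | S ((0 : ℕ) : OnePoint ℕ) = 0} ∩ ⋂ n : ℕ, {S | S ((n + 1 : ℕ) : OnePoint ℕ)
        - S (n : OnePoint ℕ) ∈ (Submodule.span ℝ {x n} : Set X)} := by
    ext S
    simp [partialSumSpace]
  rw [heq]
  refine (isClosed_eq (h _) continuous_const).inter (isClosed_iInter fun n => ?_)
  exact (Submodule.closed_of_finiteDimensional _).preimage ((h _).sub (h _))

theorem exists_coeff_of_mem_partialSumSpace {S : C(OnePoint ℕ, X)}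
    (hS : S ∈ partialSumSpace x) : ∃ a : ℕ → ℝ,
      (∀ N : ℕ, S (N : OnePoint ℕ) = ∑ n ∈ Finset.range N, a n • x n) ∧
      SeriesConvergesTo (fun n => a n • x n) (S OnePoint.infty) := by
  have h := fun n => Submodule.mem_span_singleton.1 (hS.2 n)
  choose a ha using h
  have hsum (N : ℕ) : S (N : OnePoint ℕ) = ∑ n ∈ Finset.range N, a n • x n := by
    induction N with
    | zero => simpa using hS.1
    | succ N ih => rw [Finset.sum_range_succ, ← ih, ha, add_sub_cancel]
  refine ⟨a, hsum, ?_⟩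
  have := (OnePoint.continuous_iff_from_nat S).1 S.continuous
  simpa only [SeriesConvergesTo, hsum] using this

/-- Open mapping theorem: sending a convergent sequence of partial sums to its limit is a continuous
bijection between Banach spaces, and the uniform norm on the source controls all partial sums at
once. -/
theorem IsSchauderBasis.exists_norm_sum_le [CompleteSpace X] (hx : IsSchauderBasis x) :
    ∃ C : ℝ, ∀ v N, ‖∑ n ∈ Finset.range N, hx.coeff v n • x n‖ ≤ C * ‖v‖ := by
  have : CompleteSpace (partialSumSpace x) := (isClosed_partialSumSpace x).completeSpace_coe
  let ev : partialSumSpace x →L[ℝ] X :=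
    (ContinuousMap.evalCLM ℝ OnePoint.infty).comp (partialSumSpace x).subtypeL
  have hev (S : partialSumSpace x) : ev S = (S : C(OnePoint ℕ, X)) OnePoint.infty := rfl
  have hinj : ev.ker = ⊥ := by
    refine (Submodule.eq_bot_iff _).2 fun S hS => ?_
    have hS0 : (S : C(OnePoint ℕ, X)) OnePoint.infty = 0 := hS
    obtain ⟨a, ha, hlim⟩ := exists_coeff_of_mem_partialSumSpace S.2
    have ha0 : a = 0 := by
      rw [← hx.coeff_eq hlim]
      exact hx.coeff_eq (by simp [SeriesConvergesTo, hS0])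
    ext p
    induction p using OnePoint.rec with
    | infty => exact hS0
    | coe N => simp [ha N, ha0]
  have hsurj : ev.range = ⊤ := by
    refine LinearMap.range_eq_top.2 fun v => ?_
    refine ⟨⟨OnePoint.continuousMapMkNat _ v (hx.coeff_spec v), ?_, fun n => ?_⟩, rfl⟩
    · change ∑ n ∈ Finset.range 0, hx.coeff v n • x n = 0
      simp
    · change ∑ i ∈ Finset.range (n + 1), hx.coeff v i • x i
        - ∑ i ∈ Finset.range n, hx.coeff v i • x i ∈ _
      rw [Finset.sum_range_succ, add_sub_cancel_left]
      exact Submodule.smul_mem _ _ (Submodule.mem_span_singleton_self _)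
  let e := ContinuousLinearEquiv.ofBijective ev hinj hsurj
  refine ⟨‖(e.symm : X →L[ℝ] partialSumSpace x)‖, fun v N => ?_⟩
  have hv : ((e.symm v : partialSumSpace x) : C(OnePoint ℕ, X)) OnePoint.infty = v :=
    ContinuousLinearEquiv.ofBijective_apply_symm_apply ev hinj hsurj v
  obtain ⟨a, ha, hlim⟩ := exists_coeff_of_mem_partialSumSpace (e.symm v).2
  rw [hv] at hlim
  rw [hx.coeff_eq hlim, ← ha N]
  exact (ContinuousMap.norm_coe_le_norm _ _).trans
    ((e.symm : X →L[ℝ] partialSumSpace x).le_opNorm v)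

theorem IsSchauderBasis.exists_coord [CompleteSpace X] (hx : IsSchauderBasis x) (n : ℕ) :
    ∃ f : X →L[ℝ] ℝ, ∀ v, f v = hx.coeff v n := by
  obtain ⟨C, hC⟩ := hx.exists_norm_sum_le
  let f : X →ₗ[ℝ] ℝ :=
    { toFun := fun v => hx.coeff v n
      map_add' := fun v w => by rw [hx.coeff_add]; rfl
      map_smul' := fun c v => by rw [hx.coeff_smul]; rfl }
  refine ⟨f.mkContinuous (2 * C / ‖x n‖) fun v => ?_, fun v => rfl⟩
  have h1 : hx.coeff v n • x n = ∑ i ∈ Finset.range (n + 1), hx.coeff v i • x i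
      - ∑ i ∈ Finset.range n, hx.coeff v i • x i := by
    rw [Finset.sum_range_succ, add_sub_cancel_left]
  have h2 : ‖hx.coeff v n‖ * ‖x n‖ ≤ 2 * C * ‖v‖ := by
    rw [← norm_smul, h1]
    refine (norm_sub_le _ _).trans ?_
    linarith [hC v (n + 1), hC v n]
  rw [div_mul_eq_mul_div, le_div_iff₀ (norm_pos_iff.2 (hx.ne_zero n))]
  exact h2

/-! ### Unconditionality of symmetric bases -/

theorem seriesConvergesTo_map {u : ℕ → X} {s : X} (hu : SeriesConvergesTo u s) {Y : Type*}
    [NormedAddCommGroup Y] [NormedSpace ℝ Y] (T : X →L[ℝ] Y) :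
    SeriesConvergesTo (fun n => T (u n)) (T s) := by
  simpa [SeriesConvergesTo, Function.comp_def] using (T.continuous.tendsto s).comp hu

variable [CompleteSpace X]

/-- Equality of the coefficient spaces makes the partial sum operators converge pointwise; by
Banach–Steinhaus the limit is continuous. -/
theorem IsSymmetricBasis.exists_permCLM (hx : IsSymmetricBasis x) (π : Equiv.Perm ℕ) :
    ∃ T : X →L[ℝ] X, (∀ v, SeriesConvergesTo (fun n => hx.1.coeff v n • x (π n)) (T v)) ∧
      ∀ m, T (x m) = x (π m) := by
  choose f hf using hx.1.exists_coord
  have hconv (v : X) : SeriesConverges fun n => hx.1.coeff v n • x (π n) := by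
    have h : hx.1.coeff v ∈ coef fun n => x (π n) := by
      rw [hx.2 π]
      exact ⟨v, hx.1.coeff_spec v⟩
    exact h
  choose g hg using hconv
  let A (N : ℕ) : X →L[ℝ] X := ∑ n ∈ Finset.range N, (f n).smulRight (x (π n))
  have hA : Tendsto (fun N v => A N v) atTop (𝓝 g) := by
    refine tendsto_pi_nhds.2 fun v => ?_
    simpa [A, SeriesConvergesTo, hf, sum_apply] using hg v
  refine ⟨continuousLinearMapOfTendsto A hA, hg, fun m => ?_⟩
  refine SeriesConvergesTo.unique (hg (x m)) ?_
  rw [hx.1.coeff_basis]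
  exact IsSchauderBasis.seriesConvergesTo_single (fun n => x (π n)) m

/-- With `T` and `S` the operators permuting the basis by `π` and `π⁻¹`, the rearranged series is
the expansion of `T (S v) = v`: the `k`-th coefficient of `S v` is the `π k`-th coefficient of `v`.
-/
theorem IsSymmetricBasis.seriesConvergesTo_perm (hx : IsSymmetricBasis x) (v : X)
    (π : Equiv.Perm ℕ) : SeriesConvergesTo (fun n => hx.1.coeff v (π n) • x (π n)) v := by
  obtain ⟨T, hT, hTx⟩ := hx.exists_permCLM π
  obtain ⟨S, hS, hSx⟩ := hx.exists_permCLM π.symm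
  have hTS : T (S v) = v := by
    refine SeriesConvergesTo.unique (seriesConvergesTo_map (hS v) T) ?_
    simpa [hTx] using hx.1.coeff_spec v
  have hcoeff (k : ℕ) : hx.1.coeff (S v) k = hx.1.coeff v (π k) := by
    obtain ⟨f, hf⟩ := hx.1.exists_coord k
    have h1 := seriesConvergesTo_map (hS v) f
    have h2 := IsSchauderBasis.seriesConvergesTo_single (hx.1.coeff v) (π k)
    rw [← hf]
    refine SeriesConvergesTo.unique h1 ?_
    convert h2 using 2 with n
    rw [map_smul, hf, hx.1.coeff_basis]
    by_cases h : n = π k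
    · simp [h]
    · have h' : k ≠ π.symm n := fun hk => h (by simp [hk])
      simp [h, h']
  have := hT (S v)
  rw [hTS] at this
  simpa [hcoeff] using this

end Basis

/-! ### Unconditional convergence -/

theorem exists_perm_eqOn {f : ℕ → ℕ} {A : Set ℕ} (hf : Set.InjOn f A) (hA : Aᶜ.Infinite)
    (hfA : (f '' A)ᶜ.Infinite) : ∃ π : Equiv.Perm ℕ, Set.EqOn π f A := by
  classical
  have := hA.to_subtype
  have := hfA.to_subtype
  obtain ⟨e⟩ : Nonempty ((Aᶜ : Set ℕ) ≃ ((f '' A)ᶜ : Set ℕ)) := nonempty_equiv_of_countable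
  let e₀ : A ≃ (f '' A) := Equiv.Set.imageOfInjOn f A hf
  refine ⟨((Equiv.Set.compl e₀).symm e).1, fun n hn => ?_⟩
  exact ((Equiv.Set.compl e₀).symm e).2 ⟨n, hn⟩

section Summable

variable {X : Type*} [NormedAddCommGroup X] [CompleteSpace X]

/-- A series all of whose rearrangements converge is summable. -/
theorem summable_of_forall_perm {u : ℕ → X}
    (h : ∀ π : Equiv.Perm ℕ, SeriesConverges fun n => u (π n)) : Summable u := by
  by_contra hu
  rw [summable_iff_vanishing_norm] at hu
  push Not at hu
  obtain ⟨ε, hε, ht⟩ := hu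
  choose t htd htn using ht
  -- If summability fails, there are finite sets `s k` in consecutive intervals `[N k, N (k + 1))`
  -- whose sums have norm at least `ε`. The added 2 keeps the last place of each interval out of
  -- both `s k` and the first `(s k).card` places.
  let N : ℕ → ℕ := fun k => k.rec 0 fun _ N =>
    max N (max (N + (t (Finset.range N)).card) ((t (Finset.range N)).sup id + 1)) + 2
  let s (k : ℕ) : Finset ℕ := t (Finset.range (N k))
  have hNs (k : ℕ) : N (k + 1) = max (N k) (max (N k + (s k).card) ((s k).sup id + 1)) + 2 := rfl
  have hN : StrictMono N := strictMono_nat_of_lt_succ fun k => by rw [hNs]; omega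
  have hs (k n : ℕ) (hn : n ∈ s k) : N k ≤ n ∧ n + 2 < N (k + 1) + 1 := by
    constructor
    · by_contra hlt
      exact Finset.disjoint_left.1 (htd (Finset.range (N k))) hn
        (Finset.mem_range.2 (not_le.1 hlt))
    · have : n ≤ (s k).sup id := Finset.le_sup (f := id) hn
      rw [hNs]
      omega
  choose κ hκ using exists_mem_block hN rfl
  have hκ' {n j : ℕ} (hj : N j ≤ n ∧ n < N (j + 1)) : κ n = j := block_unique hN (hκ n) hj
  -- `f` lists `s k` on the first places of the `k`-th interval. The unused last places make both
  -- complements infinite, so `f` extends to a permutation, whose partial sums then fail to be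
  -- Cauchy.
  let A : Set ℕ := {n | n < N (κ n) + (s (κ n)).card}
  let f : ℕ → ℕ := fun n => Nat.nth (· ∈ s (κ n)) (n - N (κ n))
  have hfin (k : ℕ) : {n | n ∈ s k}.Finite := (s k).finite_toSet
  have hcard (k : ℕ) : (hfin k).toFinset = s k := by ext; simp
  have hfmem (n : ℕ) (hn : n ∈ A) : f n ∈ s (κ n) := by
    have hn' : n < N (κ n) + (s (κ n)).card := hn
    have := hκ n
    refine Nat.nth_mem_of_lt_card (p := (· ∈ s (κ n))) (hfin _) ?_
    rw [hcard]
    omega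
  have hκf (n : ℕ) (hn : n ∈ A) : κ (f n) = κ n := by
    have := hs _ _ (hfmem n hn)
    exact hκ' ⟨this.1, by omega⟩
  have hlast (k : ℕ) : κ (N (k + 1) - 1) = k := by
    have := hN (show k < k + 1 by omega)
    exact hκ' ⟨by omega, by omega⟩
  have hinf {B : Set ℕ} (hB : ∀ k, N (k + 1) - 1 ∈ B) : B.Infinite := by
    refine Set.infinite_of_injective_forall_mem (f := fun k => N (k + 1) - 1) ?_ hB
    intro i j hij
    rw [← hlast i, ← hlast j]
    exact congrArg κ hij
  obtain ⟨π, hπ⟩ := exists_perm_eqOn (f := f) (A := A)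
    (by
      intro m hm n hn hmn
      have hk : κ m = κ n := by rw [← hκf m hm, ← hκf n hn, hmn]
      have hm' : m < N (κ m) + (s (κ m)).card := hm
      have hn' : n < N (κ n) + (s (κ n)).card := hn
      have h1 := hκ m
      have h2 := hκ n
      simp only [f] at hmn
      rw [hk] at hmn hm' h1
      have := Nat.nth_injOn (p := (· ∈ s (κ n))) (hfin _) (x₁ := m - N (κ n)) (x₂ := n - N (κ n))
        (by rw [hcard]; exact Set.mem_Iio.2 (by omega))
        (by rw [hcard]; exact Set.mem_Iio.2 (by omega)) hmn
      omega)
    (hinf fun k hk => by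
      have hk' : N (k + 1) - 1 < N (κ (N (k + 1) - 1)) + (s (κ (N (k + 1) - 1))).card := hk
      rw [hlast] at hk'
      have := hNs k
      omega)
    (hinf fun k => by
      rintro ⟨n, hn, hfn⟩
      have h1 := hs _ _ (hfmem n hn)
      have h2 := hκf n hn
      rw [hfn, hlast] at h2
      rw [← h2, hfn] at h1
      omega)
  obtain ⟨v, hv⟩ := h π
  have hv' : Tendsto (fun N : ℕ => ∑ n ∈ Finset.range N, u (π n)) atTop (𝓝 v) := hv
  obtain ⟨M, hM⟩ := Metric.cauchySeq_iff.1 hv'.cauchySeq ε hε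
  have hsum : ∑ n ∈ Finset.range (N M + (s M).card), u (π n) - ∑ n ∈ Finset.range (N M), u (π n)
      = ∑ n ∈ s M, u n := by
    rw [Finset.sum_range_add, add_sub_cancel_left]
    have hκi (i : ℕ) (hi : i < (s M).card) : κ (N M + i) = M := by
      have := hNs M
      exact hκ' ⟨by omega, by omega⟩
    have himg : s M = (Finset.range (s M).card).image (Nat.nth (· ∈ s M)) := by
      apply Finset.coe_injective
      have := Nat.image_nth_Iio_card (p := (· ∈ s M)) (hfin M)
      rw [hcard] at this
      rw [Finset.coe_image, Finset.coe_range, this]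
      rfl
    conv_rhs => rw [himg]
    rw [Finset.sum_image]
    · refine Finset.sum_congr rfl fun i hi => ?_
      have hi := Finset.mem_range.1 hi
      have hmem : N M + i ∈ A := by
        change N M + i < N (κ (N M + i)) + (s (κ (N M + i))).card
        rw [hκi i hi]
        omega
      rw [hπ hmem]
      simp only [f]
      rw [hκi i hi, Nat.add_sub_cancel_left]
    · have := Nat.nth_injOn (p := (· ∈ s M)) (hfin M)
      rw [hcard] at this
      simpa using this
  have h1 := hM (N M + (s M).card) (le_add_right hN.le_apply) (N M) hN.le_apply
  rw [dist_eq_norm, hsum] at h1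
  exact absurd h1 (not_lt.2 (htn _))

variable [NormedSpace ℝ X]

/-- A norming functional `g` reduces the estimate to scalars; splitting by the sign of `g (u i)`
leaves two subsums of the original family, each below `ε / 2`. -/
theorem Summable.smul_of_abs_le_one {ι : Type*} {u : ι → X} (hu : Summable u) {c : ι → ℝ}
    (hc : ∀ i, |c i| ≤ 1) : Summable fun i => c i • u i := by
  classical
  rw [summable_iff_vanishing_norm] at hu ⊢
  intro ε hε
  obtain ⟨s, hs⟩ := hu (ε / 2) (half_pos hε)
  refine ⟨s, fun t ht => ?_⟩
  obtain ⟨g, hg1, hg⟩ := exists_dual_vector'' ℝ (∑ i ∈ t, c i • u i)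
  have hsub (p : ι → Prop) [DecidablePred p] : |g (∑ i ∈ t with p i, u i)| < ε / 2 := by
    refine lt_of_le_of_lt ?_ (hs _ (Finset.disjoint_of_subset_left (Finset.filter_subset p t) ht))
    exact (g.le_opNorm _).trans (mul_le_of_le_one_left (norm_nonneg _) hg1)
  have hg' : ‖∑ i ∈ t, c i • u i‖ = g (∑ i ∈ t, c i • u i) := by simpa using hg.symm
  calc ‖∑ i ∈ t, c i • u i‖ = ∑ i ∈ t, c i * g (u i) := by
        rw [hg', map_sum]
        simp
    _ ≤ ∑ i ∈ t, |g (u i)| := Finset.sum_le_sum fun i _ => by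
        refine (le_abs_self _).trans ?_
        rw [abs_mul]
        exact mul_le_of_le_one_left (abs_nonneg _) (hc i)
    _ = g (∑ i ∈ t with 0 ≤ g (u i), u i) - g (∑ i ∈ t with ¬ 0 ≤ g (u i), u i) := by
        rw [← Finset.sum_filter_add_sum_filter_not t (fun i => 0 ≤ g (u i)), map_sum, map_sum,
          sub_eq_add_neg, ← Finset.sum_neg_distrib]
        congr 1
        · exact Finset.sum_congr rfl fun i hi => abs_of_nonneg (Finset.mem_filter.1 hi).2
        · exact Finset.sum_congr rfl fun i hi =>
            abs_of_neg (not_le.1 (Finset.mem_filter.1 hi).2)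
    _ < ε := by
        have h1 := (abs_lt.1 (hsub fun i => 0 ≤ g (u i))).2
        have h2 := (abs_lt.1 (hsub fun i => ¬ 0 ≤ g (u i))).1
        linarith

end Summable

/-! ### The coefficient space of a symmetric basis -/

namespace IsSymmetricBasis

variable {X : Type*} [NormedAddCommGroup X] [NormedSpace ℝ X] [CompleteSpace X] {x : ℕ → X}

theorem mem_coef_iff_summable (hx : IsSymmetricBasis x) {a : ℕ → ℝ} :
    a ∈ coef x ↔ Summable fun n => a n • x n := by
  constructor
  · rintro ⟨v, hv⟩
    refine summable_of_forall_perm fun π => ⟨v, ?_⟩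
    have h := hx.seriesConvergesTo_perm v π
    rwa [hx.1.coeff_eq hv] at h
  · intro h
    exact ⟨_, h.hasSum.tendsto_sum_nat⟩

theorem mem_coef_of_eventually_abs_le (hx : IsSymmetricBasis x) {a b : ℕ → ℝ} (ha : a ∈ coef x)
    (h : ∀ᶠ n in cofinite, |b n| ≤ |a n|) : b ∈ coef x := by
  rw [hx.mem_coef_iff_summable] at ha ⊢
  -- The default 0 is used at finitely many places only; where `a n = 0` the bound forces `b n = 0`.
  let c : ℕ → ℝ := fun n => if |b n| ≤ |a n| then b n / a n else 0
  have hc : Summable fun n => c n • a n • x n := by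
    refine ha.smul_of_abs_le_one fun n => ?_
    simp only [c]
    split_ifs with h
    · rw [abs_div]
      exact div_le_one_of_le₀ h (abs_nonneg _)
    · simp
  refine (summable_congr_cofinite ?_).2 hc
  filter_upwards [h] with n hn
  rw [smul_smul]
  congr 1
  simp only [c, if_pos hn]
  rcases eq_or_ne (a n) 0 with h0 | h0
  · rw [h0, abs_zero] at hn
    rw [h0, abs_nonpos_iff.1 hn]
    simp
  · rw [div_mul_cancel₀ _ h0]

theorem mem_coef_of_finite_support (hx : IsSymmetricBasis x) {a : ℕ → ℝ}
    (h : ∀ᶠ n in cofinite, a n = 0) : a ∈ coef x :=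
  hx.mem_coef_of_eventually_abs_le (coef x).zero_mem (h.mono fun n hn => by simp [hn])

theorem abs_mem_coef (hx : IsSymmetricBasis x) {a : ℕ → ℝ} (ha : a ∈ coef x) :
    (fun n => |a n|) ∈ coef x :=
  hx.mem_coef_of_eventually_abs_le ha (.of_forall fun n => by simp)

/-- On the support of `a` the injection `f` agrees with a permutation, since the infinite complement
of `A` leaves room to extend it. -/
theorem mem_coef_iff_of_eqOn (hx : IsSymmetricBasis x) {f : ℕ → ℕ} {A : Set ℕ}
    (hf : Function.Injective f) (hA : Aᶜ.Infinite) {a : ℕ → ℝ} (ha : ∀ n ∉ A, a n = 0) :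
    a ∈ coef x ↔ Summable fun n => a n • x (f n) := by
  have hfA : (f '' A)ᶜ.Infinite := by
    refine (hA.image hf.injOn).mono ?_
    rintro _ ⟨n, hn, rfl⟩ ⟨m, hm, hmn⟩
    exact hn (hf hmn ▸ hm)
  obtain ⟨π, hπ⟩ := exists_perm_eqOn hf.injOn hA hfA
  have heq : (fun n => a n • x (f n)) = fun n => a n • x (π n) := by
    ext n
    by_cases hn : n ∈ A
    · rw [hπ hn]
    · simp [ha n hn]
  rw [heq]
  constructor
  · intro h
    have h' : a ∘ π.symm ∈ coef x := by
      have h1 : a ∈ coef fun n => x (π n) := by rwa [hx.2 π]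
      obtain ⟨v, hv⟩ := h1
      -- The permuted basis is again a basis, so its coefficients are those of `x`, permuted.
      have hx' : IsSchauderBasis fun n => x (π n) := by
        intro v
        refine ⟨fun n => hx.1.coeff v (π n), hx.seriesConvergesTo_perm v π, fun b hb => ?_⟩
        obtain ⟨T, hT, hTx⟩ := hx.exists_permCLM π.symm
        have h1 := seriesConvergesTo_map hb T
        simp only [map_smul, hTx, Equiv.symm_apply_apply] at h1
        have h2 := seriesConvergesTo_map (hx.seriesConvergesTo_perm v π) T
        simp only [map_smul, hTx, Equiv.symm_apply_apply] at h2
        rw [← hx.1.coeff_eq h1, ← hx.1.coeff_eq h2]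
      have h2 : a = fun n => hx.1.coeff v (π n) :=
        (hx' v).unique hv (hx.seriesConvergesTo_perm v π)
      have h3 : a ∘ π.symm = hx.1.coeff v := by
        rw [h2]
        ext n
        simp
      rw [h3]
      exact ⟨v, hx.1.coeff_spec v⟩
    rw [hx.mem_coef_iff_summable, ← π.summable_iff] at h'
    simpa [Function.comp_def] using h'
  · intro h
    rw [← hx.2 π]
    exact ⟨_, h.hasSum.tendsto_sum_nat⟩

/-- A symmetric basis is equivalent to the sequences obtained from it by injective
reindexing. -/
theorem mem_coef_iff_summable_comp (hx : IsSymmetricBasis x) {f : ℕ → ℕ}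
    (hf : Function.Injective f) {a : ℕ → ℝ} :
    a ∈ coef x ↔ Summable fun n => a n • x (f n) := by
  classical
  -- An injection need not extend to a permutation, but its restrictions to the even and to the odd
  -- numbers do agree with permutations.
  let A : Set ℕ := {n | Even n}
  have hA : A.Infinite := Set.infinite_of_injective_forall_mem (f := fun n => 2 * n)
    (mul_right_injective₀ two_ne_zero) fun n => even_two_mul n
  have hA' : Aᶜ.Infinite := Set.infinite_of_injective_forall_mem (f := fun n => 2 * n + 1)
    (fun i j h => by simpa using h) fun n => Nat.not_even_bit1 n
  have key (B : Set ℕ) (hB : Bᶜ.Infinite) := hx.mem_coef_iff_of_eqOn hf hB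
    (a := B.indicator a) fun n hn => Set.indicator_of_notMem hn a
  have hind (B : Set ℕ) (y : ℕ → X) : (fun n => B.indicator a n • y n)
      = B.indicator fun n => a n • y n := by
    ext n
    by_cases hn : n ∈ B <;> simp [hn]
  have hcompl : Aᶜᶜ.Infinite := by rwa [compl_compl]
  constructor
  · intro h
    have h1 := (key A hA').1 (hx.mem_coef_of_eventually_abs_le h (.of_forall fun n => by
      by_cases hn : n ∈ A <;> simp [hn]))
    have h2 := (key Aᶜ hcompl).1 (hx.mem_coef_of_eventually_abs_le h (.of_forall fun n => by
      by_cases hn : n ∈ A <;> simp [hn]))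
    refine (h1.add h2).congr fun n => ?_
    rw [← add_smul, Set.indicator_self_add_compl_apply]
  · intro h
    have h1 := (key A hA').2 (by rw [hind]; exact h.indicator A)
    have h2 := (key Aᶜ hcompl).2 (by rw [hind]; exact h.indicator Aᶜ)
    have h3 := (coef x).add_mem h1 h2
    rwa [Set.indicator_self_add_compl] at h3

theorem extend_mem_coef_iff (hx : IsSymmetricBasis x) {f : ℕ → ℕ} (hf : Function.Injective f)
    {a : ℕ → ℝ} : Function.extend f a 0 ∈ coef x ↔ a ∈ coef x := by
  rw [hx.mem_coef_iff_summable, hx.mem_coef_iff_summable_comp hf, ← hf.summable_iff]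
  · simp [Function.comp_def, hf.extend_apply]
  · intro n hn
    simp [Function.extend_apply' _ _ _ hn]

theorem comp_mem_coef (hx : IsSymmetricBasis x) {f : ℕ → ℕ} (hf : Function.Injective f)
    {a : ℕ → ℝ} (ha : a ∈ coef x) : a ∘ f ∈ coef x := by
  rw [hx.mem_coef_iff_summable] at ha
  rw [hx.mem_coef_iff_summable_comp hf]
  exact ha.comp_injective hf

/-- Otherwise a subsequence decays so fast that `∑ ‖x n‖⁻¹ • x (φ n)` converges absolutely. By
symmetry `∑ ‖x n‖⁻¹ • x n` converges too, yet its terms have norm 1. -/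
theorem exists_eventually_le_norm (hx : IsSymmetricBasis x) :
    ∃ δ > 0, ∀ᶠ n in atTop, δ ≤ ‖x n‖ := by
  by_contra! h
  have hpos (n : ℕ) : 0 < ‖x n‖ := norm_pos_iff.2 (hx.1.ne_zero n)
  have hfreq (n : ℕ) : ∃ᶠ k in atTop, ‖x k‖ < (1 / 2) ^ n * ‖x n‖ := by
    have := h _ (mul_pos (pow_pos one_half_pos n) (hpos n))
    simpa using this
  obtain ⟨φ, hφ, hφ'⟩ := extraction_forall_of_frequently hfreq
  have hsum : Summable fun n => ‖x n‖⁻¹ • x (φ n) := by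
    refine Summable.of_norm_bounded summable_geometric_two fun n => ?_
    rw [norm_smul, norm_inv, norm_norm, inv_mul_le_iff₀ (hpos n), mul_comm]
    exact (hφ' n).le
  have h1 := hx.mem_coef_iff_summable.1 ((hx.mem_coef_iff_summable_comp hφ.injective).2 hsum)
  have h2 := h1.tendsto_atTop_zero.norm
  simp only [norm_smul, norm_inv, norm_norm, norm_zero] at h2
  simp only [inv_mul_cancel₀ (hpos _).ne'] at h2
  exact one_ne_zero (tendsto_nhds_unique tendsto_const_nhds h2)

/-- The same argument in the other direction: an absolutely convergent `∑ c n • x n` is carried to a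
subsequence along which the terms have norm above 1. -/
theorem exists_eventually_norm_le (hx : IsSymmetricBasis x) :
    ∃ C, ∀ᶠ n in atTop, ‖x n‖ ≤ C := by
  by_contra! h
  have hpos (n : ℕ) : 0 < 1 + ‖x n‖ := by positivity
  let c : ℕ → ℝ := fun n => (1 / 2) ^ n / (1 + ‖x n‖)
  have hc (n : ℕ) : 0 < c n := div_pos (pow_pos one_half_pos n) (hpos n)
  have hfreq (n : ℕ) : ∃ᶠ k in atTop, (c n)⁻¹ < ‖x k‖ := by
    simpa using h (c n)⁻¹
  obtain ⟨φ, hφ, hφ'⟩ := extraction_forall_of_frequently hfreq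
  have hsum : Summable fun n => c n • x n := by
    refine Summable.of_norm_bounded summable_geometric_two fun n => ?_
    rw [norm_smul, Real.norm_eq_abs, abs_of_pos (hc n), div_mul_eq_mul_div, div_le_iff₀ (hpos n)]
    have := pow_pos one_half_pos n (M₀ := ℝ)
    nlinarith
  have h1 := (hx.mem_coef_iff_summable_comp hφ.injective).1 (hx.mem_coef_iff_summable.2 hsum)
  have h2 := h1.tendsto_atTop_zero.norm
  rw [norm_zero] at h2
  obtain ⟨n, hn⟩ := (h2.eventually (gt_mem_nhds one_pos)).exists
  rw [norm_smul, Real.norm_eq_abs, abs_of_pos (hc n)] at hn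
  have h3 := mul_lt_mul_of_pos_left (hφ' n) (hc n)
  rw [mul_inv_cancel₀ (hc n).ne'] at h3
  exact lt_asymm hn h3

theorem tendsto_zero_of_mem_coef (hx : IsSymmetricBasis x) {a : ℕ → ℝ} (ha : a ∈ coef x) :
    Tendsto a atTop (𝓝 0) := by
  obtain ⟨δ, hδ, hδx⟩ := hx.exists_eventually_le_norm
  have h1 := (hx.mem_coef_iff_summable.1 ha).tendsto_atTop_zero.norm.const_mul δ⁻¹
  rw [norm_zero, mul_zero] at h1
  refine squeeze_zero_norm' ?_ h1
  filter_upwards [hδx] with n hn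
  rw [norm_smul, le_inv_mul_iff₀ hδ, mul_comm]
  exact mul_le_mul_of_nonneg_left hn (norm_nonneg _)

theorem mem_coef_of_abs_le_geometric (hx : IsSymmetricBasis x) {a : ℕ → ℝ}
    (ha : ∀ n, |a n| ≤ (1 / 2) ^ n) : a ∈ coef x := by
  obtain ⟨C, hC⟩ := hx.exists_eventually_norm_le
  rw [hx.mem_coef_iff_summable]
  refine Summable.of_norm_bounded_eventually_nat (summable_geometric_two.mul_right C) ?_
  filter_upwards [hC] with n hn
  rw [norm_smul]
  exact mul_le_mul (ha n) hn (norm_nonneg _) (by positivity)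

end IsSymmetricBasis

/-! ### Reduction to bounded sequences -/

/-- The truncation of a real number to the unit interval. -/
def clampUnit (t : ℝ) : ℝ := max 0 (min t 1)

theorem clampUnit_nonneg (t : ℝ) : 0 ≤ clampUnit t := le_max_left _ _

theorem clampUnit_le_one (t : ℝ) : clampUnit t ≤ 1 := max_le zero_le_one (min_le_right _ _)

theorem clampUnit_of_nonpos {t : ℝ} (h : t ≤ 0) : clampUnit t = 0 :=
  max_eq_left ((min_le_left _ _).trans h)

theorem clampUnit_of_one_le {t : ℝ} (h : 1 ≤ t) : clampUnit t = 1 := by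
  rw [clampUnit, min_eq_right h, max_eq_right zero_le_one]

theorem clampUnit_of_mem {t : ℝ} (h : 0 ≤ t) (h' : t ≤ 1) : clampUnit t = t := by
  rw [clampUnit, min_eq_left h', max_eq_right h]

theorem abs_clampUnit_sub_le (s t : ℝ) : |clampUnit s - clampUnit t| ≤ |s - t| := by
  refine (abs_max_sub_max_le_max 0 _ 0 _).trans (max_le (by simp) ?_)
  exact (abs_min_sub_min_le_max s 1 t 1).trans (max_le le_rfl (by simp))

theorem continuous_clampUnit : Continuous clampUnit := by
  unfold clampUnit
  fun_prop

/-- If `|s - t| < 1`, only three consecutive unit intervals can distinguish `s` and `t`. -/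
theorem clampUnit_sub_eq_zero {s t : ℝ} (h : |s - t| < 1) {k : ℤ} (h1 : k ≠ ⌊s⌋ - 1)
    (h2 : k ≠ ⌊s⌋) (h3 : k ≠ ⌊s⌋ + 1) : clampUnit (s - k) - clampUnit (t - k) = 0 := by
  have hs1 := Int.floor_le s
  have hs2 := Int.lt_floor_add_one s
  obtain ⟨h4, h5⟩ := abs_lt.1 h
  rcases lt_or_gt_of_ne h2 with hk | hk
  · have hk' : (k : ℝ) ≤ ⌊s⌋ - 2 := by exact_mod_cast (show k ≤ ⌊s⌋ - 2 by omega)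
    rw [clampUnit_of_one_le (by linarith), clampUnit_of_one_le (by linarith), sub_self]
  · have hk' : (⌊s⌋ : ℝ) + 2 ≤ k := by exact_mod_cast (show ⌊s⌋ + 2 ≤ k by omega)
    rw [clampUnit_of_nonpos (by linarith), clampUnit_of_nonpos (by linarith), sub_self]

/-- If `t ≥ s + 1`, the part of `[s, t]` in the two unit intervals from `⌊s⌋` to `⌊s⌋ + 2` has
length at least 1, so one of them sees a change of at least `1 / 2`. -/
theorem abs_sub_lt_one_of_clampUnit {s t : ℝ}
    (h : ∀ k : ℤ, |clampUnit (s - k) - clampUnit (t - k)| < 1 / 2) : |s - t| < 1 := by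
  wlog hst : s ≤ t generalizing s t
  · rw [abs_sub_comm]
    exact this (fun k => abs_sub_comm _ (clampUnit (s - k)) ▸ h k) (le_of_not_ge hst)
  by_contra! hge
  rw [abs_of_nonpos (by linarith)] at hge
  have hs1 := Int.floor_le s
  have hs2 := Int.lt_floor_add_one s
  have h1 := (abs_lt.1 (h ⌊s⌋)).1
  have h2 := (abs_lt.1 (h (⌊s⌋ + 1))).1
  rw [clampUnit_of_one_le (t := t - _) (by linarith),
    clampUnit_of_mem (by linarith) (by linarith)] at h1
  push_cast at h2
  rw [clampUnit_of_nonpos (t := s - _) (by linarith)] at h2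
  have h3 : s - ⌊s⌋ ≤ clampUnit (t - (⌊s⌋ + 1)) :=
    (le_min (by linarith) (by linarith)).trans (le_max_right _ _)
  linarith

theorem sub_eq_sum_clampUnit {s t : ℝ} (h : |s - t| < 1) :
    s - t = (clampUnit (s - (⌊s⌋ - 1 : ℤ)) - clampUnit (t - (⌊s⌋ - 1 : ℤ)))
      + (clampUnit (s - ⌊s⌋) - clampUnit (t - ⌊s⌋))
      + (clampUnit (s - (⌊s⌋ + 1 : ℤ)) - clampUnit (t - (⌊s⌋ + 1 : ℤ))) := by
  have hs1 := Int.floor_le s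
  have hs2 := Int.lt_floor_add_one s
  obtain ⟨h4, h5⟩ := abs_lt.1 h
  push_cast
  rw [clampUnit_of_one_le (t := s - (⌊s⌋ - 1)) (by linarith),
    clampUnit_of_mem (t := s - ⌊s⌋) (by linarith) (by linarith),
    clampUnit_of_nonpos (t := s - (⌊s⌋ + 1)) (by linarith)]
  rcases le_total t ⌊s⌋ with h6 | h6
  · rw [clampUnit_of_mem (t := t - (⌊s⌋ - 1)) (by linarith) (by linarith),
      clampUnit_of_nonpos (t := t - ⌊s⌋) (by linarith),
      clampUnit_of_nonpos (t := t - (⌊s⌋ + 1)) (by linarith)]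
    ring
  · rw [clampUnit_of_one_le (t := t - (⌊s⌋ - 1)) (by linarith)]
    rcases le_total t (⌊s⌋ + 1) with h7 | h7
    · rw [clampUnit_of_mem (t := t - ⌊s⌋) (by linarith) (by linarith),
        clampUnit_of_nonpos (t := t - (⌊s⌋ + 1)) (by linarith)]
      ring
    · rw [clampUnit_of_one_le (t := t - ⌊s⌋) (by linarith),
        clampUnit_of_mem (t := t - (⌊s⌋ + 1)) (by linarith) (by linarith)]
      ring

/-- The sequence in `[0, 1]` whose term with index `ι (n, k)` is the length of the part of
`[k, k + 1]` below `a n`. -/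
def spread (ι : ℕ × ℤ → ℕ) (a : ℕ → ℝ) : ℕ → ℝ :=
  Function.extend ι (fun p => clampUnit (a p.1 - p.2)) 0

theorem spread_apply {ι : ℕ × ℤ → ℕ} (hι : Function.Injective ι) (a : ℕ → ℝ) (n : ℕ) (k : ℤ) :
    spread ι a (ι (n, k)) = clampUnit (a n - k) :=
  hι.extend_apply _ _ _

theorem spread_of_notMem {ι : ℕ × ℤ → ℕ} (a : ℕ → ℝ) {m : ℕ} (hm : m ∉ Set.range ι) :
    spread ι a m = 0 :=
  Function.extend_apply' _ _ _ hm

theorem spread_mem_Icc (ι : ℕ × ℤ → ℕ) (a : ℕ → ℝ) (m : ℕ) : spread ι a m ∈ Set.Icc (0 : ℝ) 1 := by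
  classical
  simp only [spread, Function.extend_def]
  split_ifs
  · exact ⟨clampUnit_nonneg _, clampUnit_le_one _⟩
  · simp

theorem continuous_spread_apply (ι : ℕ × ℤ → ℕ) (m : ℕ) : Continuous fun a => spread ι a m := by
  classical
  simp only [spread, Function.extend_def]
  split_ifs
  · exact continuous_clampUnit.comp (by fun_prop)
  · exact continuous_const

/-- Once `|a n - b n| < 1`, only the three unit intervals around `⌊a n⌋` see a difference. So each
of the two differences is controlled by three injectively reindexed copies of the other, which
symmetry permits. -/
theorem IsSymmetricBasis.spread_sub_mem_coef_iff {X : Type*} [NormedAddCommGroup X]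
    [NormedSpace ℝ X] [CompleteSpace X] {x : ℕ → X} (hx : IsSymmetricBasis x) {ι : ℕ × ℤ → ℕ}
    (hι : Function.Injective ι) (a b : ℕ → ℝ) :
    spread ι a - spread ι b ∈ coef x ↔ a - b ∈ coef x := by
  let f : ℤ → ℕ → ℕ := fun i n => ι (n, ⌊a n⌋ + i)
  have hf (i : ℤ) : Function.Injective (f i) := fun m n h => congrArg Prod.fst (hι h)
  constructor
  · intro h
    have hsmall : ∀ᶠ n in cofinite, |a n - b n| < 1 := by
      have h0 := (hx.tendsto_zero_of_mem_coef h).abs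
      rw [abs_zero, ← Nat.cofinite_eq_atTop] at h0
      have h1 : {m | ¬ |(spread ι a - spread ι b) m| < 1 / 2}.Finite :=
        h0.eventually (gt_mem_nhds one_half_pos)
      refine ((h1.preimage hι.injOn).image Prod.fst).subset fun n hn => ?_
      by_contra hn'
      refine hn (abs_sub_lt_one_of_clampUnit fun k => ?_)
      by_contra hk
      refine hn' ⟨(n, k), ?_, rfl⟩
      simpa [spread_apply hι] using hk
    have hmem (i : ℤ) := hx.comp_mem_coef (hf i) h
    refine hx.mem_coef_of_eventually_abs_le
      ((coef x).add_mem ((coef x).add_mem (hmem (-1)) (hmem 0)) (hmem 1)) ?_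
    filter_upwards [hsmall] with n hn
    refine (congrArg abs ?_).le
    have := sub_eq_sum_clampUnit hn
    simpa [f, spread_apply hι, sub_eq_add_neg] using this
  · intro h
    have hd := hx.abs_mem_coef h
    have hsmall : ∀ᶠ n in cofinite, |a n - b n| < 1 := by
      have h0 := (hx.tendsto_zero_of_mem_coef h).abs
      rw [abs_zero, ← Nat.cofinite_eq_atTop] at h0
      exact h0.eventually (gt_mem_nhds one_pos)
    let d : ℕ → ℝ := fun n => |(a - b) n|
    let B : ℤ → ℕ → ℝ := fun i => Function.extend (f i) d 0
    have hB0 (i : ℤ) (m : ℕ) : 0 ≤ B i m := by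
      classical
      simp only [B, Function.extend_def]
      split_ifs
      · exact abs_nonneg _
      · exact le_rfl
    have hBf (i : ℤ) (n : ℕ) (k : ℤ) (hk : k = ⌊a n⌋ + i) : B i (ι (n, k)) = |a n - b n| := by
      rw [hk]
      exact (hf i).extend_apply d 0 n
    have hBmem (i : ℤ) : B i ∈ coef x := (hx.extend_mem_coef_iff (hf i)).2 hd
    refine hx.mem_coef_of_eventually_abs_le
      ((coef x).add_mem ((coef x).add_mem (hBmem (-1)) (hBmem 0)) (hBmem 1)) ?_
    -- The finitely many `n` with `|a n - b n| ≥ 1` spoil only the finitely many intervals between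
    -- the two floors.
    have hbad : (⋃ n ∈ {n | ¬ |a n - b n| < 1},
        (fun k : ℤ => ι (n, k)) '' Set.Icc (min ⌊a n⌋ ⌊b n⌋) (max ⌊a n⌋ ⌊b n⌋)).Finite :=
      Set.Finite.biUnion hsmall fun n _ => (Set.finite_Icc _ _).image _
    refine hbad.subset fun m hm => ?_
    by_contra hm'
    refine hm ?_
    change |(spread ι a - spread ι b) m| ≤ |(B (-1) + B 0 + B 1) m|
    have hnonneg : 0 ≤ (B (-1) + B 0 + B 1) m :=
      add_nonneg (add_nonneg (hB0 _ _) (hB0 _ _)) (hB0 _ _)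
    rw [abs_of_nonneg hnonneg]
    by_cases hmr : m ∈ Set.range ι
    · obtain ⟨⟨n, k⟩, rfl⟩ := hmr
      simp only [Pi.sub_apply, spread_apply hι, Pi.add_apply]
      have h1 := hB0 (-1) (ι (n, k))
      have h2 := hB0 0 (ι (n, k))
      have h3 := hB0 1 (ι (n, k))
      have hle := abs_clampUnit_sub_le (a n - k) (b n - k)
      rw [sub_sub_sub_cancel_right] at hle
      by_cases hn : |a n - b n| < 1
      · by_cases e1 : k = ⌊a n⌋ - 1
        · rw [hBf (-1) n k (by omega)]
          linarith
        by_cases e2 : k = ⌊a n⌋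
        · rw [hBf 0 n k (by omega)]
          linarith
        by_cases e3 : k = ⌊a n⌋ + 1
        · rw [hBf 1 n k e3]
          linarith
        rw [clampUnit_sub_eq_zero hn e1 e2 e3, abs_zero]
        linarith
      · have hk : ¬ (min ⌊a n⌋ ⌊b n⌋ ≤ k ∧ k ≤ max ⌊a n⌋ ⌊b n⌋) := fun hk =>
          hm' (Set.mem_biUnion (show n ∈ {n | ¬ |a n - b n| < 1} from hn) ⟨k, hk, rfl⟩)
        have ha1 := Int.floor_le (a n)
        have ha2 := Int.lt_floor_add_one (a n)
        have hb1 := Int.floor_le (b n)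
        have hb2 := Int.lt_floor_add_one (b n)
        have hz : clampUnit (a n - k) - clampUnit (b n - k) = 0 := by
          rcases lt_or_ge k (min ⌊a n⌋ ⌊b n⌋) with h4 | h4
          · have h5 : (k : ℝ) + 1 ≤ ⌊a n⌋ := by exact_mod_cast (show k + 1 ≤ ⌊a n⌋ by omega)
            have h6 : (k : ℝ) + 1 ≤ ⌊b n⌋ := by exact_mod_cast (show k + 1 ≤ ⌊b n⌋ by omega)
            rw [clampUnit_of_one_le (by linarith), clampUnit_of_one_le (by linarith), sub_self]
          · have h5 : (⌊a n⌋ : ℝ) + 1 ≤ k := by exact_mod_cast (show ⌊a n⌋ + 1 ≤ k by omega)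
            have h6 : (⌊b n⌋ : ℝ) + 1 ≤ k := by exact_mod_cast (show ⌊b n⌋ + 1 ≤ k by omega)
            rw [clampUnit_of_nonpos (by linarith), clampUnit_of_nonpos (by linarith), sub_self]
        rw [hz, abs_zero]
        linarith
    · simpa [spread_of_notMem _ hmr] using hnonneg

/-! ### Generic points for Borel maps on products of finite sets -/

/-- A Borel map into a second countable space is continuous on a residual set. -/
theorem exists_residual_continuousOn {α β : Type*} [TopologicalSpace α] [TopologicalSpace β]
    [SecondCountableTopology β] {f : α → β} (hf : @Measurable α β (borel α) (borel β) f) :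
    ∃ s ∈ residual α, ContinuousOn f s := by
  let _ : MeasurableSpace α := borel α
  have : BorelSpace α := ⟨rfl⟩
  let _ : MeasurableSpace β := borel β
  have : BorelSpace β := ⟨rfl⟩
  have hU (V : TopologicalSpace.countableBasis β) :
      ∃ U : Set α, IsOpen U ∧ f ⁻¹' (V : Set β) =ᶠ[residual α] U :=
    (hf (TopologicalSpace.isOpen_of_mem_countableBasis V.2).measurableSet).residualEq_isOpen
  choose U hUo hU using hU
  have := (TopologicalSpace.countable_countableBasis β).to_subtype
  refine ⟨⋂ V : TopologicalSpace.countableBasis β, {y | (f ⁻¹' (V : Set β)) y = U V y},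
    countable_iInter_mem.2 hU, fun y hy => ?_⟩
  have hy' (z : α) (hz : z ∈ ⋂ V : TopologicalSpace.countableBasis β,
      {y | (f ⁻¹' (V : Set β)) y = U V y})
      (V : TopologicalSpace.countableBasis β) : f z ∈ (V : Set β) ↔ z ∈ U V :=
    iff_of_eq (Set.mem_iInter.1 hz V)
  refine ((TopologicalSpace.isBasis_countableBasis β).nhds_hasBasis.tendsto_right_iff).2 ?_
  rintro V ⟨hV, hyV⟩
  have h1 := (hUo ⟨V, hV⟩).mem_nhds ((hy' y hy ⟨V, hV⟩).1 hyV)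
  filter_upwards [mem_nhdsWithin_of_mem_nhds h1, self_mem_nhdsWithin] with z hz hzs
  exact (hy' z hzs ⟨V, hV⟩).2 hz

section Product

variable {F : ℕ → Type*}

/-- The first `k` terms of `y`. -/
def initSeg (k : ℕ) (y : ∀ n, F n) : ∀ i : Fin k, F i := fun i => y i

/-- The sequence `y` with its first `k` terms replaced by `r`. -/
def splice (k : ℕ) (r : ∀ i : Fin k, F i) (y : ∀ n, F n) : ∀ n, F n :=
  fun n => if h : n < k then r ⟨n, h⟩ else y n

theorem splice_of_lt {k n : ℕ} (h : n < k) (r : ∀ i : Fin k, F i) (y : ∀ n, F n) :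
    splice k r y n = r ⟨n, h⟩ := dif_pos h

theorem splice_of_le {k n : ℕ} (h : k ≤ n) (r : ∀ i : Fin k, F i) (y : ∀ n, F n) :
    splice k r y n = y n := dif_neg (not_lt.2 h)

theorem eq_splice {k : ℕ} {y z : ∀ n, F n} (h : ∀ n, k ≤ n → y n = z n) :
    y = splice k (initSeg k y) z := by
  ext n
  by_cases hn : n < k
  · rw [splice_of_lt hn, initSeg]
  · rw [splice_of_le (not_lt.1 hn), h n (not_lt.1 hn)]

theorem splice_splice (k : ℕ) (r s : ∀ i : Fin k, F i) (y : ∀ n, F n) :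
    splice k r (splice k s y) = splice k r y := by
  ext n
  by_cases hn : n < k
  · simp [splice_of_lt hn]
  · simp [splice_of_le (not_lt.1 hn)]

/-- Changes of the first `k` terms of `y` alter `θ y` by at most `ε` far out. -/
def StableBeyond (θ : (∀ n, F n) → ℕ → ℝ) (ε : ℝ≥0∞) (k l : ℕ) (y : ∀ n, F n) : Prop :=
  ∀ r s : ∀ i : Fin k, F i, ∀ l' ≥ l,
    sqVar (seqTail l' (θ (splice k r y) - θ (splice k s y))) ≤ ε

theorem StableBeyond.of_agree {θ : (∀ n, F n) → ℕ → ℝ} {ε : ℝ≥0∞} {k l : ℕ} {y z : ∀ n, F n}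
    (h : StableBeyond θ ε k l y) (hyz : ∀ n, k ≤ n → z n = y n) : StableBeyond θ ε k l z := by
  rw [eq_splice hyz]
  intro r s l' hl'
  rw [splice_splice, splice_splice]
  exact h r s l' hl'

/-- There are finitely many pairs `(r, s)`, and each difference lies in `J`, hence has small tails.
-/
theorem exists_stableBeyond [∀ n, Finite (F n)] {θ : (∀ n, F n) → ℕ → ℝ}
    (hJ : ∀ y z : ∀ n, F n, (∃ k, ∀ n, k ≤ n → y n = z n) → θ y - θ z ∈ jamesSpace)
    {ε : ℝ≥0∞} (hε : ε ≠ 0) (k : ℕ) (y : ∀ n, F n) : ∃ l, StableBeyond θ ε k l y := by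
  have h (p : (∀ i : Fin k, F i) × (∀ i : Fin k, F i)) : ∃ l, ∀ l' ≥ l,
      sqVar (seqTail l' (θ (splice k p.1 y) - θ (splice k p.2 y))) ≤ ε := by
    have hmem := (mem_jamesSpace_iff _).1 (hJ (splice k p.1 y) (splice k p.2 y)
      ⟨k, fun n hn => by rw [splice_of_le hn, splice_of_le hn]⟩)
    exact exists_forall_sqVar_tail_le hmem.2 hmem.1 hε
  choose l hl using h
  obtain ⟨L, hL⟩ := (Set.finite_range l).bddAbove
  exact ⟨L, fun r s l' hl' => hl (r, s) l' ((hL (Set.mem_range_self (r, s))).trans hl')⟩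

variable [∀ n, TopologicalSpace (F n)]

theorem continuous_splice (k : ℕ) (r : ∀ i : Fin k, F i) : Continuous (splice k r) := by
  refine continuous_pi fun n => ?_
  unfold splice
  split_ifs
  · exact continuous_const
  · exact continuous_apply n

theorem continuous_seqTail (l : ℕ) : Continuous (seqTail l) := by
  refine continuous_pi fun n => ?_
  unfold seqTail
  split_ifs
  · exact continuous_const
  · exact continuous_apply n

theorem StableBeyond.of_mem_closure {θ : (∀ n, F n) → ℕ → ℝ} {C : Set (∀ n, F n)}
    (hC : ContinuousOn θ C) (hinv : ∀ y ∈ C, ∀ k r, splice k r y ∈ C) {ε : ℝ≥0∞} {k l : ℕ}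
    {y : ∀ n, F n} (hy : y ∈ C) (hcl : y ∈ closure {z ∈ C | StableBeyond θ ε k l z}) :
    StableBeyond θ ε k l y := by
  intro r s l' hl'
  have hcont (q : ∀ i : Fin k, F i) : ContinuousWithinAt (fun z => θ (splice k q z))
      {z ∈ C | StableBeyond θ ε k l z} y :=
    (hC _ (hinv y hy k q)).comp (continuous_splice k q).continuousWithinAt
      fun z hz => hinv z hz.1 k q
  have hdiff : ContinuousWithinAt
      (fun z => seqTail l' (θ (splice k r z) - θ (splice k s z)))
      {z ∈ C | StableBeyond θ ε k l z} y :=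
    (continuous_seqTail l').continuousAt.comp_continuousWithinAt ((hcont r).sub (hcont s))
  have := hdiff.mem_closure hcl (t := {a | sqVar a ≤ ε}) fun z hz => hz.2 r s l' hl'
  rwa [(isClosed_sqVar_le ε).closure_eq] at this

variable [∀ n, DiscreteTopology (F n)]

theorem exists_cylinder_subset {U : Set (∀ n, F n)} (hU : IsOpen U) {y : ∀ n, F n} (hy : y ∈ U) :
    ∃ n, PiNat.cylinder y n ⊆ U := by
  obtain ⟨s, ⟨z, n, rfl⟩, hys, hsU⟩ :=
    (PiNat.isTopologicalBasis_cylinders F).exists_subset_of_mem_open hy hU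
  exact ⟨n, (PiNat.mem_cylinder_iff_eq.1 hys).symm ▸ hsU⟩

/-- Needed so that preimages of comeager sets under finite changes remain comeager. -/
theorem isOpenMap_splice (k : ℕ) (r : ∀ i : Fin k, F i) : IsOpenMap (splice k r) := by
  intro U hU
  rw [isOpen_iff_forall_mem_open]
  rintro _ ⟨u, hu, rfl⟩
  obtain ⟨n, hn⟩ := exists_cylinder_subset hU hu
  refine ⟨PiNat.cylinder (splice k r u) (max n k), fun y hy => ?_, PiNat.isOpen_cylinder _ _ _,
    PiNat.self_mem_cylinder _ _⟩
  refine ⟨splice k (initSeg k u) y, hn fun i hi => ?_, ?_⟩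
  · by_cases hik : i < k
    · rw [splice_of_lt hik, initSeg]
    · rw [splice_of_le (not_lt.1 hik), hy i (lt_max_of_lt_left hi), splice_of_le (not_lt.1 hik)]
  · rw [splice_splice]
    ext i
    by_cases hik : i < k
    · rw [hy i (lt_max_of_lt_right hik), splice_of_lt hik, splice_of_lt hik]
    · rw [splice_of_le (not_lt.1 hik)]

variable [∀ n, Finite (F n)]

/-- A Borel map on a product of finite sets is continuous on a dense `Gδ` set which is invariant
under finite changes. -/
theorem exists_invariant_continuousOn {β : Type*} [TopologicalSpace β]
    [SecondCountableTopology β] {θ : (∀ n, F n) → β}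
    (hθ : @Measurable _ _ (borel (∀ n, F n)) (borel β) θ) :
    ∃ C : Set (∀ n, F n), IsGδ C ∧ C ∈ residual (∀ n, F n) ∧ ContinuousOn θ C ∧
      ∀ y ∈ C, ∀ k r, splice k r y ∈ C := by
  obtain ⟨s, hs, hc⟩ := exists_residual_continuousOn hθ
  obtain ⟨t, hts, htG, htd⟩ := mem_residual.1 hs
  -- There are countably many finite changes, because the factors are finite.
  refine ⟨⋂ p : Σ k, ∀ i : Fin k, F i, splice p.1 p.2 ⁻¹' t ∩ t, ?_, ?_, ?_, ?_⟩
  · exact IsGδ.iInter fun p => (htG.preimage (continuous_splice p.1 p.2)).inter htG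
  · have ht : t ∈ residual (∀ n, F n) := mem_residual.2 ⟨t, subset_rfl, htG, htd⟩
    exact countable_iInter_mem.2 fun p => inter_mem
      (tendsto_residual_of_isOpenMap (continuous_splice p.1 p.2) (isOpenMap_splice p.1 p.2) ht) ht
  · refine hc.mono fun y hy => hts ?_
    exact (Set.mem_iInter.1 hy ⟨0, fun i => i.elim0⟩).2
  · intro y hy k r
    have hmem (j : ℕ) (q : ∀ i : Fin j, F i) : splice j q y ∈ t := (Set.mem_iInter.1 hy ⟨j, q⟩).1
    refine Set.mem_iInter.2 fun ⟨j, q⟩ => ⟨?_, hmem k r⟩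
    have h : splice j q (splice k r y)
        = splice (max j k) (initSeg (max j k) (splice j q (splice k r y))) y := by
      refine eq_splice fun n hn => ?_
      rw [splice_of_le (le_trans (le_max_left _ _) hn),
        splice_of_le (le_trans (le_max_right _ _) hn)]
    change splice j q (splice k r y) ∈ t
    rw [h]
    exact hmem _ _

/-- For a generic point `g`, changes of the first `k` terms have uniformly small effect far out on
all points of `C` which agree with `g` on a suitable interval beyond `k`. -/
theorem residual_stableBeyond {θ : (∀ n, F n) → ℕ → ℝ} {C : Set (∀ n, F n)} (hG : IsGδ C)
    (hres : C ∈ residual (∀ n, F n)) (hC : ContinuousOn θ C)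
    (hinv : ∀ y ∈ C, ∀ k r, splice k r y ∈ C)
    (hJ : ∀ y z : ∀ n, F n, (∃ k, ∀ n, k ≤ n → y n = z n) → θ y - θ z ∈ jamesSpace)
    {ε : ℝ≥0∞} (hε : ε ≠ 0) (k : ℕ) :
    {g | ∃ l n, ∀ y ∈ C, (∀ i, k ≤ i → i < n → y i = g i) → StableBeyond θ ε k l y}
      ∈ residual (∀ n, F n) := by
  -- Baire category in the `Gδ` set `C`: the closures for varying `l` cover it.
  have hdense : Dense (⋃ l, interior (closure {z ∈ C | StableBeyond θ ε k l z})) := by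
    refine hG.dense_iUnion_interior_of_closed (dense_of_mem_residual hres)
      (fun l => isClosed_closure) fun y hy => ?_
    obtain ⟨l, hl⟩ := exists_stableBeyond hJ hε k y
    exact Set.mem_iUnion.2 ⟨l, subset_closure ⟨hy, hl⟩⟩
  have hopen : IsOpen (⋃ l, interior (closure {z ∈ C | StableBeyond θ ε k l z})) :=
    isOpen_iUnion fun l => isOpen_interior
  refine mem_of_superset (residual_of_dense_open hopen hdense) fun g hg => ?_
  obtain ⟨l, hl⟩ := Set.mem_iUnion.1 hg
  obtain ⟨n, hn⟩ := exists_cylinder_subset isOpen_interior hl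
  refine ⟨l, n, fun y hy hyg => ?_⟩
  have hmem : splice k (initSeg k g) y ∈ closure {z ∈ C | StableBeyond θ ε k l z} := by
    refine interior_subset (hn fun i hi => ?_)
    by_cases hik : i < k
    · rw [splice_of_lt hik, initSeg]
    · rw [splice_of_le (not_lt.1 hik), hyg i (not_lt.1 hik) hi]
  exact (StableBeyond.of_mem_closure hC hinv (hinv y hy k _) hmem).of_agree
    fun i hi => (splice_of_le hi _ _).symm

/-- Continuity of `θ` on `C` at the finitely many points `splice k r g`, made uniform by taking the
largest cylinder length. -/
theorem exists_trunc_close {θ : (∀ n, F n) → ℕ → ℝ} {C : Set (∀ n, F n)}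
    (hC : ContinuousOn θ C) (hinv : ∀ y ∈ C, ∀ k r, splice k r y ∈ C) {g : ∀ n, F n}
    (hg : g ∈ C) {ε : ℝ≥0∞} (hε : ε ≠ 0) (k l : ℕ) :
    ∃ n, ∀ y ∈ C, (∀ i, k ≤ i → i < n → y i = g i) → ∀ l' ≤ l,
      sqVar (seqTrunc l' (θ y - θ (splice k (initSeg k y) g))) ≤ ε := by
  have h (r : ∀ i : Fin k, F i) : ∃ n, ∀ y ∈ C, y ∈ PiNat.cylinder (splice k r g) n →
      8 * ∑ j ∈ Finset.range l, ENNReal.ofReal ((θ y j - θ (splice k r g) j) ^ 2) ≤ ε := by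
    have hmem := hinv g hg k r
    have hcont : ContinuousWithinAt (fun y =>
        8 * ∑ j ∈ Finset.range l, ENNReal.ofReal ((θ y j - θ (splice k r g) j) ^ 2)) C
        (splice k r g) := by
      have h1 : Continuous fun a : ℕ → ℝ =>
          8 * ∑ j ∈ Finset.range l, ENNReal.ofReal ((a j - θ (splice k r g) j) ^ 2) :=
        (ENNReal.continuous_const_mul (by norm_num)).comp (continuous_finsetSum _ fun j _ =>
          ENNReal.continuous_ofReal.comp (by fun_prop))
      exact h1.continuousAt.comp_continuousWithinAt (hC _ hmem)
    have h2 := hcont.eventually_le_const (u := ε) (by simpa using pos_iff_ne_zero.2 hε)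
    obtain ⟨U, hU, hgU, hUC⟩ := mem_nhdsWithin.1 h2
    obtain ⟨n, hn⟩ := exists_cylinder_subset hU hgU
    exact ⟨n, fun y hy hyn => hUC ⟨hn hyn, hy⟩⟩
  choose n hn using h
  obtain ⟨N, hN⟩ := (Set.finite_range n).bddAbove
  refine ⟨N, fun y hy hyg l' hl' => (sqVar_trunc_le l' _).trans (le_trans ?_
    (hn (initSeg k y) y hy fun i hi => ?_))⟩
  · exact mul_le_mul_right (Finset.sum_le_sum_of_subset (Finset.range_subset_range.2 hl')) 8
  · by_cases hik : i < k
    · rw [splice_of_lt hik, initSeg]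
    · rw [splice_of_le (not_lt.1 hik)]
      exact hyg i (not_lt.1 hik) (hi.trans_le (hN (Set.mem_range_self _)))

theorem exists_forall_mem_of_agree {C U : Set (∀ n, F n)} (hU : IsOpen U) (hCU : C ⊆ U)
    (hinv : ∀ y ∈ C, ∀ k r, splice k r y ∈ C) {g : ∀ n, F n} (hg : g ∈ C) (k : ℕ) :
    ∃ n, ∀ y, (∀ i, k ≤ i → i < n → y i = g i) → y ∈ U := by
  have h (r : ∀ i : Fin k, F i) := exists_cylinder_subset hU (hCU (hinv g hg k r))
  choose n hn using h
  obtain ⟨N, hN⟩ := (Set.finite_range n).bddAbove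
  refine ⟨N, fun y hyg => hn (initSeg k y) fun i hi => ?_⟩
  by_cases hik : i < k
  · rw [splice_of_lt hik, initSeg]
  · rw [splice_of_le (not_lt.1 hik)]
    exact hyg i (not_lt.1 hik) (hi.trans_le (hN (Set.mem_range_self _)))

theorem exists_generic [∀ n, Nonempty (F n)] {θ : (∀ n, F n) → ℕ → ℝ}
    (hθ : @Measurable _ _ (borel (∀ n, F n)) (borel (ℕ → ℝ)) θ)
    (hJ : ∀ y z : ∀ n, F n, (∃ k, ∀ n, k ≤ n → y n = z n) → θ y - θ z ∈ jamesSpace)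
    {ε : ℕ → ℝ≥0∞} (hε : ∀ k, ε k ≠ 0) :
    ∃ (C : Set (∀ n, F n)) (g : ∀ n, F n) (h l : ℕ → ℕ),
      (∀ y ∈ C, ∀ k r, splice k r y ∈ C) ∧ g ∈ C ∧ StrictMono l ∧ 0 < l 0 ∧
      (∀ y, (∀ K, ∃ k ≥ K, ∀ i, k ≤ i → i < h k → y i = g i) → y ∈ C) ∧
      ∀ k, ∀ y ∈ C, (∀ i, k ≤ i → i < h k → y i = g i) →
        StableBeyond θ (ε k) k (l k) y ∧ ∀ l' ≤ l k,
          sqVar (seqTrunc l' (θ y - θ (splice k (initSeg k y) g))) ≤ ε k := by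
  obtain ⟨C, hG, hres, hC, hinv⟩ := exists_invariant_continuousOn hθ
  obtain ⟨D, hD, hCD⟩ := isGδ_iff_eq_iInter_nat.1 hG
  obtain ⟨g, hgC, hg⟩ := (dense_of_mem_residual (inter_mem hres (countable_iInter_mem.2 fun k =>
    residual_stableBeyond hG hres hC hinv hJ (hε k) k))).nonempty
  choose l₀ n₀ hstab using fun k => Set.mem_iInter.1 hg k
  let l (k : ℕ) : ℕ := ∑ i ∈ Finset.range (k + 1), (l₀ i + 1)
  have hl₀ (k : ℕ) : l₀ k ≤ l k := by
    have : l₀ k + 1 ≤ l k := Finset.single_le_sum (f := fun i => l₀ i + 1)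
      (fun _ _ => Nat.zero_le _) (Finset.self_mem_range_succ k)
    omega
  choose n₁ htrunc using fun k => exists_trunc_close hC hinv hgC (hε k) k (l k)
  -- Agreement with `g` on the `k`-th window places `y` in the first `k + 1` open sets defining `C`;
  -- agreement on infinitely many windows places it in `C`.
  have hCk (k : ℕ) : C ⊆ ⋂ i ∈ Finset.range (k + 1), D i := by
    rw [hCD]
    exact Set.subset_iInter₂ fun i _ => Set.iInter_subset D i
  choose n₂ hmem using fun k => exists_forall_mem_of_agree
    (isOpen_biInter_finset (s := Finset.range (k + 1)) fun i _ => hD i) (hCk k) hinv hgC k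
  refine ⟨C, g, fun k => n₀ k + n₁ k + n₂ k, l, hinv, hgC, ?_, ?_, fun y hy => ?_,
    fun k y hyC hy => ⟨fun r s l' hl' => ?_, ?_⟩⟩
  · refine strictMono_nat_of_lt_succ fun k => ?_
    simp only [l]
    rw [Finset.sum_range_succ _ (k + 1)]
    omega
  · simp [l]
  · rw [hCD]
    refine Set.mem_iInter.2 fun i => ?_
    obtain ⟨k, hk, hyk⟩ := hy i
    have := hmem k y fun j hj hj' => hyk j hj (hj'.trans_le (Nat.le_add_left _ _))
    exact Set.mem_iInter₂.1 this i (Finset.mem_range.2 (by omega))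
  · exact hstab k y hyC (fun i hi hi' => hy i hi (by dsimp only; omega)) r s l' ((hl₀ k).trans hl')
  · exact htrunc k y hyC fun i hi hi' => hy i hi (by dsimp only; omega)

end Product

/-! ### Splitting a Borel reduction into blocks -/

theorem tsum_two_inv_pow_ne_top : ∑' k : ℕ, (2⁻¹ : ℝ≥0∞) ^ k ≠ ∞ := by
  rw [ENNReal.tsum_geometric]
  simp

theorem sqVar_block_le_of_tail {z : ℕ → ℕ} (hz : Monotone z) {j : ℕ} {a : ℕ → ℝ} {ε : ℝ≥0∞}
    (h : ∀ l ≥ z j, sqVar (seqTail l a) ≤ ε) : sqVar (seqBlock z j a) ≤ 4 * ε := by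
  rw [seqBlock_eq_tail_sub hz]
  refine (sqVar_sub_le _ _).trans ((add_le_add (mul_le_mul_right (h _ le_rfl) 2)
    (mul_le_mul_right (h _ (hz (Nat.le_succ j))) 2)).trans (le_of_eq ?_))
  ring

theorem sqVar_block_le_of_trunc {z : ℕ → ℕ} (hz : Monotone z) {j : ℕ} {a : ℕ → ℝ} {ε : ℝ≥0∞}
    (h : ∀ l ≤ z (j + 1), sqVar (seqTrunc l a) ≤ ε) : sqVar (seqBlock z j a) ≤ 4 * ε := by
  rw [seqBlock_eq_trunc_sub hz]
  refine (sqVar_sub_le _ _).trans ((add_le_add (mul_le_mul_right (h _ le_rfl) 2)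
    (mul_le_mul_right (h _ (hz (Nat.le_succ j))) 2)).trans (le_of_eq ?_))
  ring

section Product

variable {F : ℕ → Type*}

open Classical in
/-- The sequence which agrees with `u` on `S` and with `g` off `S`. -/
def mergeOn (S : Set ℕ) (u g : ∀ n, F n) : ∀ n, F n := fun n => if n ∈ S then u n else g n

theorem mergeOn_of_mem {S : Set ℕ} {n : ℕ} (h : n ∈ S) (u g : ∀ n, F n) :
    mergeOn S u g n = u n := if_pos h

theorem mergeOn_of_notMem {S : Set ℕ} {n : ℕ} (h : n ∉ S) (u g : ∀ n, F n) :
    mergeOn S u g n = g n := if_neg h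

theorem notMem_range_of_lt_of_lt {m : ℕ → ℕ} (hm : StrictMono m) {i j : ℕ} (h1 : m j < i)
    (h2 : i < m (j + 1)) : i ∉ Set.range m := by
  rintro ⟨k, rfl⟩
  have h3 := hm.lt_iff_lt.1 h1
  have h4 := hm.lt_iff_lt.1 h2
  omega

variable [∀ n, TopologicalSpace (F n)] [∀ n, DiscreteTopology (F n)] [∀ n, Finite (F n)]
  [∀ n, Nonempty (F n)]

/-- Along suitable free coordinates `m j`, the value of `θ` on the `j`-th block depends, up to an
element of James' space, only on the `j`-th free coordinate. -/
theorem exists_block_decomposition {θ : (∀ n, F n) → ℕ → ℝ}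
    (hθ : @Measurable _ _ (borel (∀ n, F n)) (borel (ℕ → ℝ)) θ)
    (hJ : ∀ y z : ∀ n, F n, (∃ k, ∀ n, k ≤ n → y n = z n) → θ y - θ z ∈ jamesSpace) :
    ∃ (g : ∀ n, F n) (m b : ℕ → ℕ), StrictMono m ∧ StrictMono b ∧ b 0 = 0 ∧
      ∀ (u : ∀ n, F n) (a : ℕ → ℝ),
        (∀ j, seqBlock b j a = seqBlock b j (θ (Function.update g (m j) (u (m j))))) →
        θ (mergeOn (Set.range m) u g) - a ∈ jamesSpace := by
  obtain ⟨C, g, h, l, hinv, hgC, hl, hl0, hCmem, hC⟩ := exists_generic hθ hJ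
    (ε := fun k => 2⁻¹ ^ k) (fun k => by simp)
  -- The gap after `m j` contains the window up to `h (m j + 1)` on which agreement with `g` is
  -- needed.
  let m : ℕ → ℕ := fun j => j.rec 0 fun _ p => p + 1 + h (p + 1)
  have hm_succ (j : ℕ) : m (j + 1) = m j + 1 + h (m j + 1) := rfl
  have hm : StrictMono m := strictMono_nat_of_lt_succ fun j => by rw [hm_succ]; omega
  let b : ℕ → ℕ := fun j => j.casesOn 0 fun i => l (m i + 1)
  have hb_succ (j : ℕ) : b (j + 1) = l (m j + 1) := rfl
  have hb : StrictMono b := strictMono_nat_of_lt_succ fun j => by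
    cases j with
    | zero => exact hl0.trans_le (hl.monotone (Nat.zero_le _))
    | succ j => exact hl (by have := hm (show j < j + 1 by omega); omega)
  refine ⟨g, m, b, hm, hb, rfl, fun u a ha => ?_⟩
  set y := mergeOn (Set.range m) u g with hy
  have hyg (j : ℕ) : ∀ i, m j + 1 ≤ i → i < h (m j + 1) → y i = g i := fun i hi hi' =>
    mergeOn_of_notMem (notMem_range_of_lt_of_lt hm (j := j) (by omega)
      (by rw [hm_succ]; omega)) u g
  have hyC : y ∈ C := hCmem y fun K => ⟨m K + 1, by have := hm.le_apply (x := K); omega, hyg K⟩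
  have hpow (j k : ℕ) (hjk : j ≤ k) : (2⁻¹ : ℝ≥0∞) ^ k ≤ 2⁻¹ ^ j :=
    pow_le_pow_of_le_one zero_le (by simp) hjk
  have hblock (j : ℕ) : sqVar (seqBlock b j (θ y - a)) ≤ 16 * 2⁻¹ ^ j := by
    set z := Function.update g (m j) (u (m j)) with hz
    set w := splice (m j + 1) (initSeg (m j + 1) y) g with hw
    have hmj : j ≤ m j := hm.le_apply
    -- Late coordinates: resetting everything after `m j` to `g` hardly changes `θ` before `b (j +
    -- 1) = l (m j + 1)`.
    have h1 : sqVar (seqBlock b j (θ y - θ w)) ≤ 4 * 2⁻¹ ^ j :=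
      (sqVar_block_le_of_trunc hb.monotone (hC _ y hyC (hyg j)).2).trans
        (mul_le_mul_right (hpow j _ (by omega)) 4)
    have hzw (i : ℕ) (hi : ∀ k, k < j → m k < i) : z i = w i := by
      rcases lt_trichotomy i (m j) with h2 | rfl | h2
      · rw [hz, hw, Function.update_of_ne h2.ne, splice_of_lt (by omega), initSeg, hy,
          mergeOn_of_notMem]
        rintro ⟨k, rfl⟩
        exact lt_irrefl _ (hi k (hm.lt_iff_lt.1 h2))
      · rw [hz, hw, Function.update_self, splice_of_lt (by omega), initSeg, hy,
          mergeOn_of_mem (Set.mem_range_self j)]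
      · rw [hz, hw, Function.update_of_ne h2.ne', splice_of_le (by omega)]
    -- Early coordinates: resetting those before `m j` to `g` hardly changes `θ` from `b j` on. For
    -- `j = 0` there is no earlier free coordinate.
    have h2 : sqVar (seqBlock b j (θ w - θ z)) ≤ 4 * 2⁻¹ ^ j := by
      cases j with
      | zero =>
        have : z = w := funext fun i => hzw i fun k hk => absurd hk (Nat.not_lt_zero k)
        rw [this, sub_self]
        have h0 : seqBlock b 0 0 = 0 := by ext; simp [seqBlock]
        rw [h0, sqVar_zero]
        exact zero_le
      | succ i =>
        have hzC : z ∈ C := by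
          have : z = splice (m (i + 1) + 1) (initSeg _ z) g := eq_splice fun n hn => by
            rw [hz, Function.update_of_ne (by omega)]
          rw [this]
          exact hinv g hgC _ _
        have hzg : ∀ n, m i + 1 ≤ n → n < h (m i + 1) → z n = g n := fun n hn hn' => by
          rw [hz, Function.update_of_ne]
          have := hm_succ i
          omega
        have hwz : w = splice (m i + 1) (initSeg _ w) z := eq_splice fun n hn => by
          refine (hzw n fun k hk => ?_).symm
          have := hm.monotone (Nat.le_of_lt_succ hk)
          omega
        have hzz : z = splice (m i + 1) (initSeg _ z) z := eq_splice fun n _ => rfl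
        have hst := (hC _ z hzC hzg).1 (initSeg _ w) (initSeg _ z)
        rw [← hwz, ← hzz] at hst
        refine (sqVar_block_le_of_tail hb.monotone hst).trans (mul_le_mul_right (hpow _ _ ?_) 4)
        have := hm.le_apply (x := i)
        omega
    have h3 : seqBlock b j (θ y - a) = seqBlock b j (θ y - θ w) + seqBlock b j (θ w - θ z) := by
      rw [← seqBlock_add, sub_add_sub_cancel, seqBlock_sub, seqBlock_sub, ha j]
    rw [h3]
    refine (sqVar_add_le _ _).trans ((add_le_add (mul_le_mul_right h1 2)
      (mul_le_mul_right h2 2)).trans (le_of_eq ?_))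
    ring
  refine mem_jamesSpace_of_tsum_block hb rfl ((ENNReal.tsum_le_tsum hblock).trans_lt ?_).ne
  rw [ENNReal.tsum_mul_left]
  exact ENNReal.mul_lt_top (by simp) tsum_two_inv_pow_ne_top.lt_top

/-- Along suitable free coordinates `p j`, a Borel map `θ` which respects finite changes modulo
James' space is equivalent to a sequence of maps of single coordinates into finite dimensional
spaces, modulo the `ℓ₂`-sum of their quadratic variations. -/
theorem exists_coordinatewise_reduction {θ : (∀ n, F n) → ℕ → ℝ}
    (hθ : @Measurable _ _ (borel (∀ n, F n)) (borel (ℕ → ℝ)) θ)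
    (hJ : ∀ y z : ∀ n, F n, (∃ k, ∀ n, k ≤ n → y n = z n) → θ y - θ z ∈ jamesSpace) :
    ∃ (g : ∀ n, F n) (p q : ℕ → ℕ) (W : ∀ j, F (p j) → ℕ → ℝ),
      Function.Injective p ∧ Function.Injective q ∧ (∀ j c i, q j < i → W j c i = 0) ∧
      ∀ u v : ∀ n, F n,
        θ (mergeOn (Set.range p) u g) - θ (mergeOn (Set.range p) v g) ∈ jamesSpace ↔
          ∑' j, sqVar (W j (u (p j)) - W j (v (p j))) ≠ ∞ := by
  obtain ⟨g, m, b, hm, hb, hb0, hdec⟩ := exists_block_decomposition hθ hJ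
  -- Only the odd free coordinates stay free. The even ones are frozen at `g`, so differences of the
  -- block model `cat` vanish on even blocks.
  let p : ℕ → ℕ := fun j => m (2 * j + 1)
  have hp : Function.Injective p := fun i j hij => by
    have := hm.injective hij
    omega
  let T (u : ∀ n, F n) (j : ℕ) : ℕ → ℝ := θ (Function.update g (m j) (u (m j)))
  let W (j : ℕ) (c : F (p j)) : ℕ → ℝ := seqBlock b (2 * j + 1) (θ (Function.update g (p j) c))
  -- `b (2 * j + 2) - 1` is the last index of block `2 * j + 1`, so `W j` fits into `J^n` with `n =
  -- q j + 1`.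
  refine ⟨g, p, fun j => b (2 * j + 2) - 1, W, hp, ?_, ?_, fun u v => ?_⟩
  · intro i j hij
    have h1 := hb (show 0 < 2 * i + 2 by omega)
    have h2 := hb (show 0 < 2 * j + 2 by omega)
    have := hb.injective (show b (2 * i + 2) = b (2 * j + 2) by dsimp only at hij; omega)
    omega
  · intro j c i hi
    exact if_neg fun h => by
      have : i < b (2 * j + 2) := h.2
      dsimp only at hi
      omega
  choose κ hκ using exists_mem_block hb hb0
  have hκ' {n j : ℕ} (hj : b j ≤ n ∧ n < b (j + 1)) : κ n = j := block_unique hb (hκ n) hj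
  let cat (u : ∀ n, F n) : ℕ → ℝ := fun n => T u (κ n) n
  have hcat (u : ∀ n, F n) (j : ℕ) : seqBlock b j (cat u) = seqBlock b j (T u j) := by
    ext n
    simp only [seqBlock]
    split_ifs with hn
    · simp only [cat, hκ' hn]
    · rfl
  let ext' (u : ∀ n, F n) : ∀ n, F n := mergeOn (Set.range p) u g
  have hmerge (u : ∀ n, F n) : mergeOn (Set.range m) (ext' u) g = ext' u := by
    ext n
    by_cases hn : n ∈ Set.range m
    · rw [mergeOn_of_mem hn]
    · have hn' : n ∉ Set.range p := by
        rintro ⟨j, rfl⟩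
        exact hn ⟨_, rfl⟩
      simp only [ext', mergeOn_of_notMem hn, mergeOn_of_notMem hn']
  have hmem (u : ∀ n, F n) : θ (ext' u) - cat (ext' u) ∈ jamesSpace := by
    have := hdec (ext' u) (cat (ext' u)) (hcat (ext' u))
    rwa [hmerge] at this
  have heven (u : ∀ n, F n) (j : ℕ) : T (ext' u) (2 * j) = θ g := by
    have : m (2 * j) ∉ Set.range p := by
      rintro ⟨i, hi⟩
      have := hm.injective hi
      omega
    simp only [T, ext']
    rw [mergeOn_of_notMem this, Function.update_eq_self]
  have hodd (u : ∀ n, F n) (j : ℕ) : seqBlock b (2 * j + 1) (T (ext' u) (2 * j + 1))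
      = W j (u (p j)) := by
    simp only [T, W, ext']
    rw [mergeOn_of_mem (Set.mem_range_self (f := p) j)]
  let D : ℕ → ℝ := cat (ext' u) - cat (ext' v)
  have hDeven (j n : ℕ) (hn : b (2 * j) ≤ n ∧ n < b (2 * j + 1)) : D n = 0 := by
    simp only [D, cat, Pi.sub_apply]
    rw [hκ' hn, heven, heven, sub_self]
  let z : ℕ → ℕ := fun j => b (2 * j)
  have hz : StrictMono z := fun i j hij => hb (by omega)
  have hblock (j : ℕ) : seqBlock z j D = W j (u (p j)) - W j (v (p j)) := by
    rw [← hodd, ← hodd, ← hcat, ← hcat, ← seqBlock_sub]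
    ext n
    have h1 := hb (show 2 * j < 2 * j + 1 by omega)
    simp only [seqBlock]
    by_cases hn : b (2 * j + 1) ≤ n ∧ n < b (2 * j + 1 + 1)
    · rw [if_pos hn, if_pos ⟨h1.le.trans hn.1, hn.2⟩]
    · rw [if_neg hn, ite_eq_right_iff]
      intro hn'
      refine hDeven j n ⟨hn'.1, ?_⟩
      by_contra hlt
      exact hn ⟨not_lt.1 hlt, hn'.2⟩
  have hiff : θ (ext' u) - θ (ext' v) ∈ jamesSpace ↔ D ∈ jamesSpace := by
    have hD : θ (ext' u) - θ (ext' v) = D + ((θ (ext' u) - cat (ext' u))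
        - (θ (ext' v) - cat (ext' v))) := by
      simp only [D]
      abel
    rw [hD]
    exact jamesSpace.add_mem_iff_left (jamesSpace.sub_mem (hmem u) (hmem v))
  have hz0 : z 0 = 0 := hb0
  refine hiff.trans ?_
  simp_rw [← hblock]
  constructor
  · intro h
    refine ((tsum_sqVar_block_le hz.monotone fun j => hDeven j _ ⟨le_rfl, hb (by omega)⟩).trans_lt
      ((mem_jamesSpace_iff D).1 h).2.lt_top).ne
  · exact mem_jamesSpace_of_tsum_block hz hz0

end Product

/-! ### The main theorem -/

/-- The points of the grid `{0, 2⁻ⁿ, 2 · 2⁻ⁿ, …, 1}`, as a real sequence. -/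
def gridValue (y : ∀ n : ℕ, Fin (2 ^ n + 1)) : ℕ → ℝ := fun n => (y n : ℕ) / 2 ^ n

/-- Rounding of a sequence in `[0, 1]` to the grids `{0, 2⁻ⁿ, 2 · 2⁻ⁿ, …, 1}`. -/
def gridRound (a : ℕ → ℝ) : ∀ n : ℕ, Fin (2 ^ n + 1) := fun n => Fin.ofNat _ ⌊2 ^ n * a n⌋₊

theorem continuous_gridValue : Continuous gridValue :=
  continuous_pi fun n => (continuous_of_discreteTopology (f := fun c : Fin (2 ^ n + 1) =>
    ((c : ℕ) : ℝ) / 2 ^ n)).comp (continuous_apply n)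

theorem abs_gridValue_gridRound_sub_le {a : ℕ → ℝ} {n : ℕ} (h : a n ∈ Set.Icc (0 : ℝ) 1) :
    gridValue (gridRound a) n ≤ a n ∧ a n - (1 / 2) ^ n ≤ gridValue (gridRound a) n := by
  have h2 : (0 : ℝ) < 2 ^ n := by positivity
  have h3 : 0 ≤ 2 ^ n * a n := mul_nonneg h2.le h.1
  -- This bound ensures that the reduction modulo `2 ^ n + 1` in `Fin.ofNat` changes nothing.
  have h4 : ⌊2 ^ n * a n⌋₊ ≤ 2 ^ n := by
    refine Nat.floor_le_of_le ?_
    push_cast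
    exact mul_le_of_le_one_right h2.le h.2
  have h5 : gridValue (gridRound a) n = ⌊2 ^ n * a n⌋₊ / 2 ^ n := by
    simp only [gridValue, gridRound, Fin.val_ofNat]
    rw [Nat.mod_eq_of_lt (Nat.lt_succ_of_le h4)]
  rw [h5]
  constructor
  · rw [div_le_iff₀ h2, mul_comm (a n)]
    exact Nat.floor_le h3
  · rw [le_div_iff₀ h2, sub_mul, ← mul_pow]
    have := Nat.lt_floor_add_one (2 ^ n * a n)
    norm_num
    linarith

theorem measurable_gridRound_spread (ι : ℕ × ℤ → ℕ) :
    @Measurable _ _ (borel (ℕ → ℝ)) (borel (∀ n : ℕ, Fin (2 ^ n + 1)))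
      fun a => gridRound (spread ι a) := by
  rw [← BorelSpace.measurable_eq (α := ℕ → ℝ),
    ← BorelSpace.measurable_eq (α := ∀ n : ℕ, Fin (2 ^ n + 1))]
  refine measurable_pi_lambda _ fun n => ?_
  exact (measurable_of_countable fun k : ℕ => Fin.ofNat (2 ^ n + 1) k).comp
    (Nat.measurable_floor.comp ((continuous_spread_apply ι n).measurable.const_mul _))

/-- Rounding errors are at most `2⁻ⁿ`, and such sequences are coefficients because the basis is
bounded. -/
theorem IsSymmetricBasis.gridValue_sub_mem_coef_iff {X : Type*} [NormedAddCommGroup X]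
    [NormedSpace ℝ X] [CompleteSpace X] {x : ℕ → X} (hx : IsSymmetricBasis x) {a b : ℕ → ℝ}
    (ha : ∀ n, a n ∈ Set.Icc (0 : ℝ) 1) (hb : ∀ n, b n ∈ Set.Icc (0 : ℝ) 1) :
    gridValue (gridRound a) - gridValue (gridRound b) ∈ coef x ↔ a - b ∈ coef x := by
  have h : (gridValue (gridRound a) - gridValue (gridRound b)) - (a - b) ∈ coef x := by
    refine hx.mem_coef_of_abs_le_geometric fun n => abs_le.2 ?_
    have h1 := abs_gridValue_gridRound_sub_le (ha n)
    have h2 := abs_gridValue_gridRound_sub_le (hb n)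
    simp only [Pi.sub_apply]
    constructor <;> linarith [h1.1, h1.2, h2.1, h2.2]
  rw [← sub_add_cancel (gridValue (gridRound a) - gridValue (gridRound b)) (a - b)]
  exact (coef x).add_mem_iff_right h

/-- The finite sequences `w j`, placed in the space `J^n` with `n = q j + 1`. -/
def placeSummand (q : ℕ → ℕ) (w : ℕ → ℕ → ℝ) (k : ℕ) : JamesFin (k + 1) :=
  fun i => Function.extend q w 0 k i

theorem padZero_placeSummand_sub {q : ℕ → ℕ} (hq : Function.Injective q) {v w : ℕ → ℕ → ℝ}
    (hv : ∀ j i, q j < i → v j i = 0) (hw : ∀ j i, q j < i → w j i = 0) (j : ℕ) :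
    padZero (placeSummand q v (q j) - placeSummand q w (q j)) = v j - w j := by
  rw [padZero_sub]
  ext i
  simp only [padZero, placeSummand, hq.extend_apply, Pi.sub_apply]
  split_ifs with h
  · rfl
  · rw [hv j i (by omega), hw j i (by omega)]

theorem tsum_sqVar_placeSummand {q : ℕ → ℕ} (hq : Function.Injective q) {v w : ℕ → ℕ → ℝ}
    (hv : ∀ j i, q j < i → v j i = 0) (hw : ∀ j i, q j < i → w j i = 0) :
    ∑' k, sqVar (padZero (placeSummand q v k - placeSummand q w k))
      = ∑' j, sqVar (v j - w j) := by
  rw [← hq.tsum_eq]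
  · simp_rw [padZero_placeSummand_sub hq hv hw]
  · intro k hk
    by_contra hk'
    refine hk ?_
    have h : placeSummand q v k - placeSummand q w k = 0 := by
      funext i
      change Function.extend q v 0 k i - Function.extend q w 0 k i = 0
      rw [Function.extend_apply' _ _ _ hk', Function.extend_apply' _ _ _ hk', sub_self]
    simp only [h, padZero_zero, sqVar_zero]

theorem IsSymmetricBasis.borelReducible_decomposition {X : Type*} [NormedAddCommGroup X]
    [NormedSpace ℝ X] [CompleteSpace X] {x : ℕ → X} (hx : IsSymmetricBasis x)
    (h : BorelReducible (schauderSetoid x) (sequenceSetoid jamesSpace)) :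
    BorelReducible (schauderSetoid x) (decompositionSetoid jamesSummand) := by
  obtain ⟨θ, hθ, hred⟩ := h
  have hred' (a b : ℕ → ℝ) : θ a - θ b ∈ jamesSpace ↔ a - b ∈ coef x := (hred a b).symm
  obtain ⟨g, p, q, W, hp, hq, hW, hiff⟩ := exists_coordinatewise_reduction
    (F := fun n => Fin (2 ^ n + 1)) (θ := fun y => θ (gridValue y))
    (@Measurable.comp _ _ _ (borel _) (borel _) (borel _) _ _ hθ
      continuous_gridValue.borel_measurable)
    (by
      rintro y z ⟨k, hk⟩
      rw [hred']
      refine hx.mem_coef_of_finite_support ?_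
      rw [Nat.cofinite_eq_atTop]
      filter_upwards [eventually_ge_atTop k] with n hn
      simp [gridValue, hk n hn])
  obtain ⟨e⟩ : Nonempty (ℕ × ℤ ≃ ℕ) := nonempty_equiv_of_countable
  -- Spreading onto exactly the free coordinates: elsewhere the spread sequences are 0, so
  -- overwriting them by `g` leaves differences unchanged.
  let ι : ℕ × ℤ → ℕ := p ∘ e
  have hι : Function.Injective ι := hp.comp e.injective
  have hιp : Set.range ι = Set.range p := e.surjective.range_comp p
  let U (a : ℕ → ℝ) : ∀ n : ℕ, Fin (2 ^ n + 1) := gridRound (spread ι a)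
  have hU (a b : ℕ → ℝ) : a - b ∈ coef x ↔
      ∑' j, sqVar (W j (U a (p j)) - W j (U b (p j))) ≠ ∞ := by
    rw [← hiff, hred', ← hx.spread_sub_mem_coef_iff hι,
      ← hx.gridValue_sub_mem_coef_iff (spread_mem_Icc ι a) (spread_mem_Icc ι b)]
    suffices heq : gridValue (mergeOn (Set.range p) (U a) g)
        - gridValue (mergeOn (Set.range p) (U b) g)
        = gridValue (gridRound (spread ι a)) - gridValue (gridRound (spread ι b)) by rw [heq]
    ext n
    simp only [gridValue, Pi.sub_apply]
    by_cases hn : n ∈ Set.range p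
    · rw [mergeOn_of_mem hn, mergeOn_of_mem hn]
    · have hn' : n ∉ Set.range ι := by rwa [hιp]
      rw [mergeOn_of_notMem hn, mergeOn_of_notMem hn, sub_self]
      simp [gridRound, spread_of_notMem _ hn']
  let Ψ (y : ∀ n : ℕ, Fin (2 ^ n + 1)) (k : ℕ) : jamesSummand k :=
    ⟨lp.lsingle (𝕜 := ℝ) (E := fun k : ℕ => JamesFin (k + 1)) 2 k
      (placeSummand q (fun j => W j (y (p j))) k), LinearMap.mem_range_self _ _⟩
  have hΨ (y : ∀ n : ℕ, Fin (2 ^ n + 1)) (k : ℕ) :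
      (Ψ y k : JamesSum) k = placeSummand q (fun j => W j (y (p j))) k :=
    lp.single_apply_self _ _ _
  -- Each component depends on at most one coordinate, which ranges over a finite discrete set.
  have hcont : Continuous Ψ := by
    classical
    refine continuous_pi fun k => ?_
    by_cases hk : ∃ j, q j = k
    · obtain ⟨j, rfl⟩ := hk
      let G (c : Fin (2 ^ p j + 1)) : jamesSummand (q j) :=
        ⟨lp.lsingle (𝕜 := ℝ) (E := fun k : ℕ => JamesFin (k + 1)) 2 (q j)
          (fun i => W j c i : JamesFin (q j + 1)), LinearMap.mem_range_self _ _⟩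
      have hG : (fun y => Ψ y (q j)) = fun y => G (y (p j)) := by
        ext1 y
        have hy : placeSummand q (fun j => W j (y (p j))) (q j)
            = (fun i => W j (y (p j)) i : JamesFin (q j + 1)) :=
          funext fun i => congrFun (hq.extend_apply (fun j => W j (y (p j))) 0 j) i
        simp only [Ψ, G, hy]
      rw [hG]
      exact (continuous_of_discreteTopology (f := G)).comp (continuous_apply (p j))
    · have hG : (fun y => Ψ y k) = fun _ => 0 := by
        ext1 y
        refine Subtype.ext ((congrArg _ (funext fun i => ?_)).trans (map_zero _))
        change Function.extend q (fun j => W j (y (p j))) 0 k i = 0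
        rw [Function.extend_apply' _ _ _ hk]
        rfl
      rw [hG]
      exact continuous_const
  refine ⟨fun a => Ψ (U a), @Measurable.comp _ _ _ (borel _) (borel _) (borel _) _ _
    hcont.borel_measurable (measurable_gridRound_spread ι), fun a b => ?_⟩
  rw [decompositionSetoid_iff]
  simp_rw [hΨ]
  rw [tsum_sqVar_placeSummand hq (fun j i => hW j _ i) (fun j i => hW j _ i)]
  exact hU a b

end

theorem theorem6p2 {X : Type*} [NormedAddCommGroup X] [NormedSpace ℝ X] [CompleteSpace X]
    (x : ℕ → X) (hx : IsSymmetricBasis x) :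
    BorelReducible (schauderSetoid x) (sequenceSetoid jamesSpace) ↔
      BorelReducible (schauderSetoid x) (decompositionSetoid jamesSummand) :=
  ⟨hx.borelReducible_decomposition, fun h => h.trans borelReducible_decomposition_jamesSpace⟩
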